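/- **Conventions.** Homomorphisms of $C^*$-algebras are $*$-preserving; ideals are closed and two-sided; $A/J$ is the quotient $C^*$-algebra with quotient map $q$; $M(A)$ is the multiplier algebra with unit $1$. A homomorphism $A\to B$ is *extendible* if it extends to a strictly continuous homomorphism $M(A)\to M(B)$. The extension of such a homomorphism, and more generally a strictly continuous extension $M(A)\to M(B)$ of a map $A\to B$, is unique if it exists and is denoted by a bar. A *$C^*$-dynamical system* $(A,\alpha)$ is a $C^*$-algebra $A$ with an extendible endomorphism $\alpha:A\to A$. Put $(\ker\alpha)^\perp=\{a\in A: ac=0 \text{ for all } c\in\ker\alpha\}$. A *morphism* $T:(A,\alpha)\to(B,\beta)$ is a homomorphism $T:A\to B$ that is non-degenerate (the span of $T(A)B$ is dense in $B$) and satisfies $T\circ\alpha=\beta\circ T$; an injective morphism is an *embedding*, and then $(B,\beta)$ is an *extension* of $(A,\alpha)$. A bijective morphism is an *equivalence*. A *complete transfer operator* for $(A,\alpha)$ is a (necessarily unique) positive linear map $\alpha_*:A\to A$ with $\alpha_*(\alpha(a)b)=a\,\alpha_*(b)$ and $\alpha(\alpha_*(a))=\overline\alpha(1)\,a\,\overline\alpha(1)$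 for all $a,b\in A$; the system $(A,\alpha)$ is *reversible* if it has one. In that case $\overline{\alpha}_*$ denotes the strictly continuous extension of $\alpha_*$ to $M(A)$. For an ideal $J$ of $A$ with $J\subseteq(\ker\alpha)^\perp$, an embedding $T:(A,\alpha)\to(B,\beta)$ is a *$J$-embedding* if $J=T^{-1}((\ker\beta)^\perp)$, and a *covariant embedding* if this holds with $J=(\ker\alpha)^\perp$. A *reversible $J$-extension* of $(A,\alpha)$ is a reversible system $(B,\beta)$ together with a $J$-embedding of $(A,\alpha)$ into $(B,\beta)$. **The construction.** Let $(A,\alpha)$ be a $C^*$-dynamical system and $J$ an ideal of $A$ contained in $(\ker\alpha)^\perp$. For $n\ge 0$ put $A_n=\overline\alpha^{\,n}(1)A\,\overline\alpha^{\,n}(1)$, $$B_n=q(A_0)\oplus\dots\oplus q(A_{n-1})\oplus A_n,$$ $$\beta_n(a_0\oplus\dots\oplus a_n)=a_1\oplus\dots\oplus a_{n-1}\oplus q(a_n)\oplus\alpha(a_n)\quad(\beta_0=\alpha),$$ $$T_n:B_n\to B_{n+1},\qquad T_n(a_0\oplus\dots\oplus a_n)=a_0\oplus\dots\oplus a_{n-1}\oplus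 q(a_n)\oplus\alpha(a_n).$$ Let $B$ be the $C^*$-algebraic direct limit of $B_0\xrightarrow{T_0}B_1\xrightarrow{T_1}\cdots$, let $\beta$ be the endomorphism of $B$ induced by the $\beta_n$, and let $T:A=B_0\to B$ be the natural map. **Theorem.** $(B,\beta)$ is a $C^*$-dynamical system, and it is a reversible $J$-extension of $(A,\alpha)$ with the embedding $T$. Moreover: (i) $B$ is the closed linear span of $\bigcup_{n\ge0}\beta_*^n(T(A))$, and $J=\{a\in A:\overline\beta_*(1)T(a)=T(a)\}$. (ii) For every reversible $J$-extension $(C,\gamma)$ of $(A,\alpha)$, with $J$-embedding $S$, there is a unique covariant embedding $\widetilde S$ of $(B,\beta)$ into $(C,\gamma)$ such that $S=\widetilde S\circ T$. (iii) Let $(C,\gamma)$ be a reversible system and $S$ an embedding of $(A,\alpha)$ into $(C,\gamma)$. If $(C,\gamma)$ and $S$ have the property in (i) (that is, $C$ is the closed linear span of $\bigcup_n\gamma_*^n(S(A))$ and $J=\{a\in A:\overline\gamma_*(1)S(a)=S(a)\}$), or the property in (ii) (that is, for every reversible $J$-extension $(D,\delta)$ of $(A,\alpha)$ with $J$-embedding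 $R$ there is a unique covariant embedding $\Phi$ of $(C,\gamma)$ into $(D,\delta)$ with $R=\Phi\circ S$), then $(C,\gamma)$ is equivalent to $(B,\beta)$, by an equivalence $W:B\to C$ with $W\circ T=S$. -/

import Mathlib

namespace CStarDyn
open scoped CStarAlgebra in
theorem approx_aux {A : Type*} [NonUnitalCStarAlgebra A] (a : A) {ε : ℝ} (hε : 0 ≤ ε)
    (F : ℝ → ℝ) (hFc : Continuous F) (F0 : F 0 = 0) (hF0 : ∀ t, 0 ≤ F t) (hF1 : ∀ t, F t ≤ 1)
    (hF : ∀ t, 0 ≤ t → t * (1 - F t) ^ 2 ≤ ε ^ 2) (u : A) (hu : u = cfcₙ F (star a * a)) :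
    IsSelfAdjoint u ∧ ‖a - a * u‖ ≤ ε ∧ (∀ x : A, ‖x - x * u‖ ≤ ‖x‖) ∧
      ∀ x : A, ‖x - u * x‖ ≤ ‖x‖ := by
  let := CStarAlgebra.spectralOrder A
  have := CStarAlgebra.spectralOrderedRing A
  let := CStarAlgebra.spectralOrder (A⁺¹)
  have := CStarAlgebra.spectralOrderedRing (A⁺¹)
  have hsa : IsSelfAdjoint (star a * a) := IsSelfAdjoint.star_mul_self a
  have hpos : 0 ≤ star a * a := star_mul_self_nonneg a
  have husa : IsSelfAdjoint u := hu ▸ cfcₙ_predicate _ _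
  have hu0 : 0 ≤ u := hu ▸ cfcₙ_nonneg fun t _ => hF0 t
  have hu1 : ‖u‖ ≤ 1 := hu ▸ norm_cfcₙ_le fun t _ => by
    rw [Real.norm_eq_abs, abs_of_nonneg (hF0 t)]; exact hF1 t
  have key : ‖(1 : A⁺¹) - (u : A⁺¹)‖ ≤ 1 := by
    have h1 : (u : A⁺¹) ∈ Set.Icc 0 1 :=
      CStarAlgebra.mem_Icc_iff_norm_le_one.mpr
        ⟨Unitization.inr_nonneg_iff.mpr hu0, by rwa [Unitization.norm_inr (𝕜 := ℂ)]⟩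
    exact (CStarAlgebra.mem_Icc_iff_norm_le_one.mp (Set.sub_mem_Icc_zero_iff_right.mpr h1)).2
  refine ⟨husa, ?_, fun x => ?_, fun x => ?_⟩
  · have e1 : star (a - a * u) * (a - a * u) = cfcₙ (fun t => t * (1 - F t) ^ 2) (star a * a) := by
      have e2 : (fun t => t * (1 - F t) ^ 2) = fun t => (t - t * F t) - F t * (t - t * F t) := by
        funext t; ring
      have c1 : Continuous fun t => t * F t := continuous_id.mul hFc
      have c2 : Continuous fun t => t - t * F t := continuous_id.sub c1
      have c3 : Continuous fun t => F t * (t - t * F t) := hFc.mul c2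
      have z1 : (0 : ℝ) * F 0 = 0 := zero_mul _
      have z2 : (0 : ℝ) - 0 * F 0 = 0 := by rw [z1, sub_zero]
      have e3 : cfcₙ (fun t => t - t * F t) (star a * a) = star a * a - star a * a * u := by
        rw [cfcₙ_sub (fun t => t) (fun t => t * F t) _ continuousOn_id rfl c1.continuousOn z1,
          cfcₙ_mul (fun t => t) F _ continuousOn_id rfl hFc.continuousOn F0,
          cfcₙ_id' ℝ (star a * a), hu]
      rw [e2, cfcₙ_sub (fun t => t - t * F t) (fun t => F t * (t - t * F t)) _ c2.continuousOn z2
          c3.continuousOn (by rw [z2, mul_zero]),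
        cfcₙ_mul F (fun t => t - t * F t) _ hFc.continuousOn F0 c2.continuousOn z2, e3, ← hu,
        star_sub, star_mul, husa.star_eq]
      noncomm_ring
    have e4 : ‖star (a - a * u) * (a - a * u)‖ ≤ ε ^ 2 := by
      rw [e1]
      refine norm_cfcₙ_le fun t ht => ?_
      have ht0 : 0 ≤ t := quasispectrum_nonneg_of_nonneg _ hpos t ht
      rw [Real.norm_eq_abs, abs_of_nonneg (by positivity)]
      exact hF t ht0
    rw [CStarRing.norm_star_mul_self, ← sq] at e4
    exact (abs_le_of_sq_le_sq' e4 hε).2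
  · calc ‖x - x * u‖ = ‖(x : A⁺¹) * (1 - (u : A⁺¹))‖ := by
          rw [← Unitization.norm_inr (𝕜 := ℂ), Unitization.inr_sub, Unitization.inr_mul, mul_sub,
            mul_one]
      _ ≤ ‖(x : A⁺¹)‖ * ‖1 - (u : A⁺¹)‖ := norm_mul_le _ _
      _ ≤ ‖(x : A⁺¹)‖ * 1 := by gcongr
      _ = ‖x‖ := by rw [mul_one, Unitization.norm_inr (𝕜 := ℂ)]
  · calc ‖x - u * x‖ = ‖(1 - (u : A⁺¹)) * (x : A⁺¹)‖ := by
          rw [← Unitization.norm_inr (𝕜 := ℂ), Unitization.inr_sub, Unitization.inr_mul, sub_mul,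
            one_mul]
      _ ≤ ‖1 - (u : A⁺¹)‖ * ‖(x : A⁺¹)‖ := norm_mul_le _ _
      _ ≤ 1 * ‖(x : A⁺¹)‖ := by gcongr
      _ = ‖x‖ := by rw [one_mul, Unitization.norm_inr (𝕜 := ℂ)]

theorem exists_approx {A : Type*} [NonUnitalCStarAlgebra A] (a : A) {ε : ℝ} (hε : 0 < ε) :
    ∃ w : A, IsSelfAdjoint (star a * a * w) ∧ ‖a - a * (star a * a * w)‖ ≤ ε ∧
      (∀ x : A, ‖x - x * (star a * a * w)‖ ≤ ‖x‖) ∧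
      ∀ x : A, ‖x - star a * a * w * x‖ ≤ ‖x‖ := by
  set c : ℝ := (ε ^ 2)⁻¹ ^ 2 with hc
  have hc0 : 0 < c := by positivity
  have hd : ∀ t : ℝ, 0 < 1 + c * t ^ 2 := fun t => by positivity
  set g : ℝ → ℝ := fun t => c * t / (1 + c * t ^ 2) with hg
  have hgc : Continuous g :=
    Continuous.div (by fun_prop) (by fun_prop) fun t => (hd t).ne'
  have hg0 : g 0 = 0 := by simp [hg]
  have hf : ∀ t, t * g t = 1 - 1 / (1 + c * t ^ 2) := fun t => by
    have := (hd t).ne'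
    simp only [hg]; field_simp; ring
  have hmul : star a * a * cfcₙ g (star a * a) = cfcₙ (fun t => t * g t) (star a * a) := by
    rw [cfcₙ_mul (fun t => t) g _ continuousOn_id rfl hgc.continuousOn hg0,
      cfcₙ_id' ℝ (star a * a) (IsSelfAdjoint.star_mul_self a)]
  refine ⟨cfcₙ g (star a * a), approx_aux a hε.le (fun t => t * g t) (continuous_id.mul hgc)
    (zero_mul _) (fun t => ?_) (fun t => ?_) (fun t ht => ?_) _ hmul⟩
  · have := hd t
    have e : t * g t = c * t ^ 2 / (1 + c * t ^ 2) := by simp only [hg]; ring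
    rw [e]; positivity
  · have := hd t
    have : 0 ≤ 1 / (1 + c * t ^ 2) := by positivity
    rw [hf t]; linarith
  · have hdt := hd t
    rw [hf t]
    have : t * (1 - (1 - 1 / (1 + c * t ^ 2))) ^ 2 = t / (1 + c * t ^ 2) ^ 2 := by
      field_simp; ring
    rw [this, div_le_iff₀ (by positivity)]
    have h2 : t ≤ ε ^ 2 * (1 + c * t ^ 2) := by
      have h3 : ε ^ 2 * (1 + c * t ^ 2) = ε ^ 2 + (ε ^ 2)⁻¹ * t ^ 2 := by
        rw [hc]; field_simp
      have h5 : (ε - ε⁻¹ * t) ^ 2 = ε ^ 2 + (ε ^ 2)⁻¹ * t ^ 2 - 2 * t := by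
        field_simp; ring
      have h4 := sq_nonneg (ε - ε⁻¹ * t)
      rw [h3]; linarith
    have h6 : 1 + c * t ^ 2 ≤ (1 + c * t ^ 2) ^ 2 := by
      have : 0 ≤ c * t ^ 2 := by positivity
      nlinarith
    calc t ≤ ε ^ 2 * (1 + c * t ^ 2) := h2
      _ ≤ _ := by gcongr

/-- An ideal of a C⋆-algebra, in the usual sense: a norm-closed two-sided ideal. -/
structure ClosedIdeal (A : Type*) [NonUnitalCStarAlgebra A] extends Submodule ℂ A where
  isClosed' : IsClosed carrier
  mul_mem_left' : ∀ (a : A) {x : A}, x ∈ carrier → a * x ∈ carrier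
  mul_mem_right' : ∀ (a : A) {x : A}, x ∈ carrier → x * a ∈ carrier

namespace ClosedIdeal

section Quotient

variable {A : Type*} [NonUnitalCStarAlgebra A] (J : ClosedIdeal A)

instance : IsClosed (J.toSubmodule : Set A) := J.isClosed'

theorem mul_left (a : A) {x : A} (hx : x ∈ J.toSubmodule) : a * x ∈ J.toSubmodule :=
  J.mul_mem_left' a hx

theorem mul_right (a : A) {x : A} (hx : x ∈ J.toSubmodule) : x * a ∈ J.toSubmodule :=
  J.mul_mem_right' a hx

/-- Closed ideals of C⋆-algebras are self-adjoint. -/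
theorem star_mem {x : A} (hx : x ∈ J.toSubmodule) : star x ∈ J.toSubmodule := by
  have hcl : IsClosed (J.toSubmodule : Set A) := J.isClosed'
  rw [← SetLike.mem_coe, ← hcl.closure_eq, Metric.mem_closure_iff]
  intro ε hε
  obtain ⟨w, -, h, -⟩ := exists_approx (star x) (half_pos hε)
  refine ⟨_, ?_, (dist_eq_norm _ _).trans_lt (h.trans_lt (half_lt_self hε))⟩
  rw [star_star]
  exact J.mul_left _ (J.mul_right _ (J.mul_right _ hx))

/-- The quotient C⋆-algebra `A/J`. -/
def Quot : Type _ := A ⧸ J.toSubmodule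

noncomputable local instance quotNormedAddCommGroup : NormedAddCommGroup J.Quot :=
  inferInstanceAs (NormedAddCommGroup (A ⧸ J.toSubmodule))

noncomputable local instance quotNormedSpace : NormedSpace ℂ J.Quot :=
  inferInstanceAs (NormedSpace ℂ (A ⧸ J.toSubmodule))

local instance quotCompleteSpace : CompleteSpace J.Quot := inferInstanceAs (CompleteSpace (A ⧸ J.toSubmodule))

/-- The class of `a` in `A/J`. -/
def cls (a : A) : J.Quot := (Submodule.Quotient.mk a : A ⧸ J.toSubmodule)

theorem cls_eq {a b : A} : J.cls a = J.cls b ↔ a - b ∈ J.toSubmodule :=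
  Submodule.Quotient.eq J.toSubmodule

theorem cls_surjective : Function.Surjective J.cls :=
  Submodule.Quotient.mk_surjective J.toSubmodule

theorem cls_add (a b : A) : J.cls (a + b) = J.cls a + J.cls b := rfl

theorem cls_smul (c : ℂ) (a : A) : J.cls (c • a) = c • J.cls a := rfl

theorem cls_zero : J.cls 0 = 0 := rfl

theorem norm_cls_le (a : A) : ‖J.cls a‖ ≤ ‖a‖ := Submodule.Quotient.norm_mk_le _ a

theorem exists_cls (x : J.Quot) {ε : ℝ} (hε : 0 < ε) :
    ∃ a : A, J.cls a = x ∧ ‖a‖ < ‖x‖ + ε :=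
  Submodule.Quotient.norm_mk_lt x hε

theorem rel_iff {a b : A} : @HasEquiv.Equiv A (@instHasEquivOfSetoid A J.toSubmodule.quotientRel) a b ↔
    a - b ∈ J.toSubmodule := J.toSubmodule.quotientRel_def

local instance quotMul : Mul J.Quot where
  mul := Quotient.map₂ (· * ·) fun a a' h b b' h' => by
    rw [J.rel_iff] at h h' ⊢
    have e : a * b - a' * b' = (a - a') * b + a' * (b - b') := by noncomm_ring
    rw [e]
    exact add_mem (J.mul_right _ h) (J.mul_left _ h')

local instance quotStar : Star J.Quot where
  star := Quotient.map star fun a a' h => by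
    rw [J.rel_iff] at h ⊢
    rw [← star_sub]
    exact J.star_mem h

theorem cls_mul (a b : A) : J.cls (a * b) = J.cls a * J.cls b := rfl

theorem cls_star (a : A) : J.cls (star a) = star (J.cls a) := rfl

theorem norm_sq_le (x : J.Quot) : ‖x‖ * ‖x‖ ≤ ‖star x * x‖ := by
  obtain ⟨a, rfl⟩ := J.cls_surjective x
  rw [← cls_star, ← cls_mul]
  refine le_of_forall_pos_le_add fun ε hε => ?_
  obtain ⟨b, hb, hb'⟩ := J.exists_cls (J.cls (star a * a)) (half_pos hε)
  rw [cls_eq] at hb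
  set j : A := star a * a - b with hj
  have hjJ : j ∈ J.toSubmodule := by
    rw [hj, ← neg_sub]; exact neg_mem hb
  obtain ⟨w, hsa, h1, h2, h3⟩ := exists_approx j (half_pos hε)
  set u : A := star j * j * w with hu
  have huJ : u ∈ J.toSubmodule := J.mul_right _ (J.mul_left _ hjJ)
  have e1 : J.cls a = J.cls (a - a * u) := by
    rw [cls_eq, sub_sub_cancel]; exact J.mul_left _ huJ
  have e2 : star (a - a * u) * (a - a * u) =
      ((b - b * u) - u * (b - b * u)) + ((j - j * u) - u * (j - j * u)) := by
    have : star a * a = b + j := by rw [hj]; abel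
    have e3 : star (a - a * u) * (a - a * u) =
        ((star a * a) - (star a * a) * u) - u * ((star a * a) - (star a * a) * u) := by
      rw [star_sub, star_mul, hsa.star_eq]; noncomm_ring
    rw [e3, this]; noncomm_ring
  calc ‖J.cls a‖ * ‖J.cls a‖ ≤ ‖a - a * u‖ * ‖a - a * u‖ := by
        rw [e1]; gcongr <;> exact J.norm_cls_le _
    _ = ‖star (a - a * u) * (a - a * u)‖ := (CStarRing.norm_star_mul_self).symm
    _ ≤ ‖(b - b * u) - u * (b - b * u)‖ + ‖(j - j * u) - u * (j - j * u)‖ := by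
        rw [e2]; exact norm_add_le _ _
    _ ≤ ‖b‖ + ε / 2 := add_le_add ((h3 _).trans (h2 _)) ((h3 _).trans h1)
    _ ≤ ‖J.cls (star a * a)‖ + ε := by linarith

noncomputable local instance quotNonUnitalNormedRing : NonUnitalNormedRing J.Quot where
  __ := (inferInstance : NormedAddCommGroup J.Quot)
  mul := (· * ·)
  left_distrib x y z := by
    obtain ⟨a, rfl⟩ := J.cls_surjective x
    obtain ⟨b, rfl⟩ := J.cls_surjective y
    obtain ⟨c, rfl⟩ := J.cls_surjective z
    exact congrArg J.cls (mul_add a b c)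
  right_distrib x y z := by
    obtain ⟨a, rfl⟩ := J.cls_surjective x
    obtain ⟨b, rfl⟩ := J.cls_surjective y
    obtain ⟨c, rfl⟩ := J.cls_surjective z
    exact congrArg J.cls (add_mul a b c)
  zero_mul x := by
    obtain ⟨a, rfl⟩ := J.cls_surjective x
    exact congrArg J.cls (zero_mul a)
  mul_zero x := by
    obtain ⟨a, rfl⟩ := J.cls_surjective x
    exact congrArg J.cls (mul_zero a)
  mul_assoc x y z := by
    obtain ⟨a, rfl⟩ := J.cls_surjective x
    obtain ⟨b, rfl⟩ := J.cls_surjective y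
    obtain ⟨c, rfl⟩ := J.cls_surjective z
    exact congrArg J.cls (mul_assoc a b c)
  norm_mul_le x y := by
    refine le_of_forall_pos_le_add fun ε hε => ?_
    have : Filter.Tendsto (fun δ : ℝ => (‖x‖ + δ) * (‖y‖ + δ)) (nhdsWithin 0 (Set.Ioi 0))
        (nhds (‖x‖ * ‖y‖)) := by
      have h : Continuous fun δ : ℝ => (‖x‖ + δ) * (‖y‖ + δ) := by fun_prop
      simpa using (h.tendsto 0).mono_left nhdsWithin_le_nhds
    obtain ⟨δ, hδ, hδ0⟩ := ((this.eventually (gt_mem_nhds (lt_add_of_pos_right _ hε))).and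
      self_mem_nhdsWithin).exists
    obtain ⟨a, rfl, ha⟩ := J.exists_cls x hδ0
    obtain ⟨b, rfl, hb⟩ := J.exists_cls y hδ0
    calc ‖J.cls (a * b)‖ ≤ ‖a‖ * ‖b‖ := (J.norm_cls_le _).trans (norm_mul_le _ _)
      _ ≤ _ := by gcongr
      _ ≤ _ := hδ.le

noncomputable local instance quotStarRing : StarRing J.Quot where
  star_involutive x := by
    obtain ⟨a, rfl⟩ := J.cls_surjective x
    exact congrArg J.cls (star_star a)
  star_mul x y := by
    obtain ⟨a, rfl⟩ := J.cls_surjective x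
    obtain ⟨b, rfl⟩ := J.cls_surjective y
    exact congrArg J.cls (star_mul a b)
  star_add x y := by
    obtain ⟨a, rfl⟩ := J.cls_surjective x
    obtain ⟨b, rfl⟩ := J.cls_surjective y
    exact congrArg J.cls (star_add a b)

noncomputable instance quotCStarAlgebra : NonUnitalCStarAlgebra J.Quot where
  norm_mul_self_le x := J.norm_sq_le x
  smul_assoc c x y := by
    obtain ⟨a, rfl⟩ := J.cls_surjective x
    obtain ⟨b, rfl⟩ := J.cls_surjective y
    exact congrArg J.cls (smul_mul_assoc c a b)
  smul_comm c x y := by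
    obtain ⟨a, rfl⟩ := J.cls_surjective x
    obtain ⟨b, rfl⟩ := J.cls_surjective y
    exact congrArg J.cls (mul_smul_comm c a b).symm
  star_smul c x := by
    obtain ⟨a, rfl⟩ := J.cls_surjective x
    exact congrArg J.cls (star_smul c a)

end Quotient

variable {A : Type*} [NonUnitalCStarAlgebra A] (J : ClosedIdeal A)

/-- The quotient map `q : A → A/J`. -/
def q : A →⋆ₙₐ[ℂ] J.Quot where
  toFun := J.cls
  map_smul' _ _ := rfl
  map_zero' := rfl
  map_add' _ _ := rfl
  map_mul' _ _ := rfl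
  map_star' _ := rfl

theorem q_surjective : Function.Surjective J.q := J.cls_surjective

theorem q_eq {a b : A} : J.q a = J.q b ↔ a - b ∈ J.toSubmodule := J.cls_eq

/-- The homomorphism `A/I → B/J` induced by `f : A → B` with `f(I) ⊆ J`. -/
def mapQ {B : Type*} [NonUnitalCStarAlgebra B] (I : ClosedIdeal A) (J : ClosedIdeal B)
    (f : A →⋆ₙₐ[ℂ] B) (h : ∀ x ∈ I.toSubmodule, f x ∈ J.toSubmodule) :
    I.Quot →⋆ₙₐ[ℂ] J.Quot where
  toFun := Quotient.map f fun a b hab => by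
    rw [I.rel_iff] at hab
    rw [J.rel_iff]
    rw [← map_sub]; exact h _ hab
  map_smul' c x := by
    obtain ⟨a, rfl⟩ := I.cls_surjective x
    exact congrArg J.cls (map_smul f c a)
  map_zero' := congrArg J.cls (map_zero f)
  map_add' x y := by
    obtain ⟨a, rfl⟩ := I.cls_surjective x
    obtain ⟨b, rfl⟩ := I.cls_surjective y
    exact congrArg J.cls (map_add f a b)
  map_mul' x y := by
    obtain ⟨a, rfl⟩ := I.cls_surjective x
    obtain ⟨b, rfl⟩ := I.cls_surjective y
    exact congrArg J.cls (map_mul f a b)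
  map_star' x := by
    obtain ⟨a, rfl⟩ := I.cls_surjective x
    exact congrArg J.cls (map_star f a)

theorem mapQ_q {B : Type*} [NonUnitalCStarAlgebra B] (I : ClosedIdeal A) (J : ClosedIdeal B)
    (f : A →⋆ₙₐ[ℂ] B) (h : ∀ x ∈ I.toSubmodule, f x ∈ J.toSubmodule) (a : A) :
    mapQ I J f h (I.q a) = J.q (f a) := rfl

end ClosedIdeal

section Multipliers

open scoped MultiplierAlgebra

variable {A B : Type*} [NonUnitalCStarAlgebra A] [NonUnitalCStarAlgebra B]

/-- The strict topology on the multiplier algebra: `m_i → m` if and only if `m_i a → m a` and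
`a m_i → a m` in norm for every `a` (equivalently, `m_i a → m a` and `m_i* a → m* a`). -/
noncomputable abbrev strictTopology (A : Type*) [NonUnitalCStarAlgebra A] : TopologicalSpace 𝓜(ℂ, A) :=
  TopologicalSpace.induced
    (fun m : 𝓜(ℂ, A) => ((fun a => m.fst a, fun a => m.snd a) : (A → A) × (A → A))) inferInstance

/-- `F : M(A) → M(B)` is a strictly continuous map extending `f : A → B`. -/
structure IsStrictExtension (f : A → B) (F : 𝓜(ℂ, A) → 𝓜(ℂ, B)) : Prop where
  continuous : @Continuous _ _ (strictTopology A) (strictTopology B) F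
  extends_apply : ∀ a : A, F (DoubleCentralizer.coe ℂ a) = DoubleCentralizer.coe ℂ (f a)

/-- A homomorphism is extendible if it extends to a strictly continuous homomorphism of
multiplier algebras. -/
def Extendible (f : A →⋆ₙₐ[ℂ] B) : Prop :=
  ∃ F : 𝓜(ℂ, A) →⋆ₙₐ[ℂ] 𝓜(ℂ, B), IsStrictExtension f F

/-- The (unique) strictly continuous extension `M(A) → M(B)` of an extendible homomorphism. -/
noncomputable def Extendible.ext {f : A →⋆ₙₐ[ℂ] B} (hf : Extendible f) :
    𝓜(ℂ, A) →⋆ₙₐ[ℂ] 𝓜(ℂ, B) := hf.choose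

theorem Extendible.ext_spec {f : A →⋆ₙₐ[ℂ] B} (hf : Extendible f) :
    IsStrictExtension f hf.ext := hf.choose_spec

theorem eq_of_forall_mul_eq {x y : A} (h : ∀ z : A, z * x = z * y) : x = y := by
  have : star (x - y) * (x - y) = 0 := by rw [mul_sub, h, sub_self]
  exact sub_eq_zero.mp ((CStarRing.star_mul_self_eq_zero_iff _).mp this)

theorem eq_of_forall_eq_mul {x y : A} (h : ∀ z : A, x * z = y * z) : x = y := by
  have : (x - y) * star (x - y) = 0 := by rw [sub_mul, h, sub_self]
  exact sub_eq_zero.mp ((CStarRing.mul_star_self_eq_zero_iff _).mp this)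

theorem fst_mul (m : 𝓜(ℂ, A)) (a b : A) : m.fst (a * b) = m.fst a * b :=
  eq_of_forall_mul_eq fun z => by rw [← m.central, ← mul_assoc, m.central, mul_assoc]

theorem snd_mul (m : 𝓜(ℂ, A)) (a b : A) : m.snd (a * b) = a * m.snd b :=
  eq_of_forall_eq_mul fun z => by rw [m.central, mul_assoc, mul_assoc, m.central]

theorem coe_fst_apply (m : 𝓜(ℂ, A)) (a : A) :
    DoubleCentralizer.coe ℂ (m.fst a) = m * DoubleCentralizer.coe ℂ a := by
  refine DoubleCentralizer.ext ℂ A _ _ (Prod.ext ?_ ?_)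
  · ext b; simp [fst_mul]
  · ext b; simp [m.central]

theorem coe_snd_apply (m : 𝓜(ℂ, A)) (a : A) :
    DoubleCentralizer.coe ℂ (m.snd a) = DoubleCentralizer.coe ℂ a * m := by
  refine DoubleCentralizer.ext ℂ A _ _ (Prod.ext ?_ ?_)
  · ext b; simp [m.central]
  · ext b; simp [snd_mul]

theorem coe_injective {a b : A}
    (h : (DoubleCentralizer.coe ℂ a : 𝓜(ℂ, A)) = DoubleCentralizer.coe ℂ b) : a = b := by
  refine eq_of_forall_eq_mul fun z => ?_
  have := congrArg (fun m : 𝓜(ℂ, A) => m.fst z) h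
  simpa using this

theorem Extendible.map_fst {f : A →⋆ₙₐ[ℂ] B} (hf : Extendible f) (m : 𝓜(ℂ, A)) (a : A) :
    f (m.fst a) = (hf.ext m).fst (f a) :=
  coe_injective <| by
    rw [coe_fst_apply, ← hf.ext_spec.extends_apply, coe_fst_apply, map_mul,
      hf.ext_spec.extends_apply]

theorem Extendible.map_snd {f : A →⋆ₙₐ[ℂ] B} (hf : Extendible f) (m : 𝓜(ℂ, A)) (a : A) :
    f (m.snd a) = (hf.ext m).snd (f a) :=
  coe_injective <| by
    rw [coe_snd_apply, ← hf.ext_spec.extends_apply, coe_snd_apply, map_mul,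
      hf.ext_spec.extends_apply]

theorem ClosedIdeal.fst_mem (J : ClosedIdeal A) (m : 𝓜(ℂ, A)) {x : A} (hx : x ∈ J.toSubmodule) :
    m.fst x ∈ J.toSubmodule := by
  have hcl : IsClosed (J.toSubmodule : Set A) := J.isClosed'
  have hcl' : IsClosed (m.fst ⁻¹' (J.toSubmodule : Set A)) := hcl.preimage m.fst.continuous
  change x ∈ m.fst ⁻¹' (J.toSubmodule : Set A)
  rw [← hcl'.closure_eq, Metric.mem_closure_iff]
  intro ε hε
  obtain ⟨w, hsa, h, -⟩ := exists_approx (star x) (half_pos hε)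
  refine ⟨star (star x * (star (star x) * star x * w)), ?_, ?_⟩
  · rw [star_mul, hsa.star_eq, star_star]
    change m.fst _ ∈ J.toSubmodule
    rw [fst_mul]
    exact J.mul_left _ hx
  · rw [dist_eq_norm]
    calc ‖x - star (star x * (star (star x) * star x * w))‖
        = ‖star x - star x * (star (star x) * star x * w)‖ := by
          rw [← norm_star, star_sub, star_star]
      _ < ε := h.trans_lt (half_lt_self hε)

theorem ClosedIdeal.snd_mem (J : ClosedIdeal A) (m : 𝓜(ℂ, A)) {x : A} (hx : x ∈ J.toSubmodule) :
    m.snd x ∈ J.toSubmodule := by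
  have h := J.star_mem ((J.fst_mem (star m)) (J.star_mem hx))
  rwa [DoubleCentralizer.star_fst, star_star, star_star] at h

/-- The corner `pAp` of `A` given by a projection `p ∈ M(A)`. -/
def corner (p : 𝓜(ℂ, A)) (hp : IsStarProjection p) : NonUnitalStarSubalgebra ℂ A where
  carrier := {a | p.fst a = a ∧ p.snd a = a}
  add_mem' {a b} ha hb := ⟨by rw [map_add, ha.1, hb.1], by rw [map_add, ha.2, hb.2]⟩
  zero_mem' := ⟨map_zero _, map_zero _⟩
  mul_mem' {a b} ha hb := ⟨by rw [fst_mul, ha.1], by rw [snd_mul, hb.2]⟩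
  smul_mem' c a ha := ⟨by rw [map_smul, ha.1], by rw [map_smul, ha.2]⟩
  star_mem' {a} ha := by
    have h1 := congrArg (fun m : 𝓜(ℂ, A) => m.fst (star a)) hp.isSelfAdjoint.star_eq
    have h2 := congrArg (fun m : 𝓜(ℂ, A) => m.snd (star a)) hp.isSelfAdjoint.star_eq
    simp only [DoubleCentralizer.star_fst, DoubleCentralizer.star_snd, star_star] at h1 h2
    exact ⟨by rw [← h1, ha.2], by rw [← h2, ha.1]⟩

theorem mem_corner {p : 𝓜(ℂ, A)} {hp : IsStarProjection p} {a : A} :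
    a ∈ corner p hp ↔ p.fst a = a ∧ p.snd a = a := Iff.rfl

theorem mem_corner_iff_exists {p : 𝓜(ℂ, A)} {hp : IsStarProjection p} {a : A} :
    a ∈ corner p hp ↔ ∃ b : A, p.fst (p.snd b) = a := by
  refine ⟨fun h => ⟨a, by rw [h.2, h.1]⟩, ?_⟩
  rintro ⟨b, rfl⟩
  have h1 : ∀ x, p.fst (p.fst x) = p.fst x := fun x =>
    congrArg (fun m : 𝓜(ℂ, A) => m.fst x) hp.isIdempotentElem
  have h2 : ∀ x, p.snd (p.snd x) = p.snd x := fun x =>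
    congrArg (fun m : 𝓜(ℂ, A) => m.snd x) hp.isIdempotentElem
  have h3 : p.snd (p.fst (p.snd b)) = p.fst (p.snd (p.snd b)) := coe_injective <| by
    simp only [coe_fst_apply, coe_snd_apply, mul_assoc]
  exact ⟨h1 _, by rw [h3, h2]⟩

theorem isClosed_corner (p : 𝓜(ℂ, A)) (hp : IsStarProjection p) :
    IsClosed (corner p hp : Set A) :=
  (isClosed_eq p.fst.continuous continuous_id).inter (isClosed_eq p.snd.continuous continuous_id)

/-- The image of a corner of `A` in a quotient of `A` is closed. -/
theorem isClosed_map_corner (J : ClosedIdeal A) (p : 𝓜(ℂ, A)) (hp : IsStarProjection p) :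
    IsClosed ((corner p hp).map J.q : Set J.Quot) := by
  let F : J.Quot → J.Quot := Quotient.map (fun a => p.fst (p.snd a)) fun a b hab => by
    rw [J.rel_iff] at hab ⊢
    rw [← map_sub, ← map_sub]
    exact J.fst_mem _ (J.snd_mem _ hab)
  have hF : ∀ a, F (J.q a) = J.q (p.fst (p.snd a)) := fun a => rfl
  have hFc : Continuous F := by
    refine Continuous.quotient_map' ?_ _
    exact p.fst.continuous.comp p.snd.continuous
  have e : ((corner p hp).map J.q : Set J.Quot) = {x | F x = x} := by
    ext x
    constructor
    · rintro ⟨a, ha, rfl⟩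
      change F (J.q a) = J.q a
      rw [hF, ha.2, ha.1]
    · intro hx
      obtain ⟨a, rfl⟩ := J.q_surjective x
      exact ⟨p.fst (p.snd a), mem_corner_iff_exists.mpr ⟨a, rfl⟩, hx⟩
  rw [e]
  exact isClosed_eq hFc continuous_id

end Multipliers

/-- Restriction of a homomorphism to subalgebras of the domain and the codomain. -/
def restrictHom {A B : Type*} [NonUnitalCStarAlgebra A] [NonUnitalCStarAlgebra B]
    (f : A →⋆ₙₐ[ℂ] B) (S : NonUnitalStarSubalgebra ℂ A) (T : NonUnitalStarSubalgebra ℂ B)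
    (h : ∀ x ∈ S, f x ∈ T) : S →⋆ₙₐ[ℂ] T where
  toFun x := ⟨f x, h x x.2⟩
  map_smul' c x := Subtype.ext (map_smul f c x.1)
  map_zero' := Subtype.ext (map_zero f)
  map_add' x y := Subtype.ext (map_add f x.1 y.1)
  map_mul' x y := Subtype.ext (map_mul f x.1 y.1)
  map_star' x := Subtype.ext (map_star f x.1)

section DirectLimit

open scoped ENNReal
open Filter Topology

variable {X : ℕ → Type*} [∀ n, NonUnitalCStarAlgebra (X n)]

/-- A bounded sequence of elements `x n ∈ X n`, as an element of the `ℓ^∞`-product. -/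
noncomputable def toLp (x : ∀ n, X n) (C : ℝ) (h : ∀ n, ‖x n‖ ≤ C) : lp X ∞ :=
  ⟨x, memℓp_infty ⟨C, by rintro _ ⟨n, rfl⟩; exact h n⟩⟩

/-- The ideal of null sequences in the `ℓ^∞`-product of a sequence of C⋆-algebras. -/
noncomputable def nullIdeal (X : ℕ → Type*) [∀ n, NonUnitalCStarAlgebra (X n)] : ClosedIdeal (lp X ∞) where
  carrier := {x | Tendsto (fun n => ‖x n‖) atTop (𝓝 0)}
  add_mem' {x y} hx hy := by
    refine squeeze_zero (fun n => norm_nonneg _) (fun n => norm_add_le (x n) (y n)) ?_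
    simpa using hx.add hy
  zero_mem' := by
    change Tendsto (fun n => ‖(0 : X n)‖) atTop (𝓝 0)
    simp
  smul_mem' c x hx := by
    refine squeeze_zero (fun n => norm_nonneg _) (fun n => (norm_smul_le c (x n))) ?_
    simpa using hx.const_mul ‖c‖
  isClosed' := by
    refine isClosed_of_closure_subset fun x hx => ?_
    rw [Metric.mem_closure_iff] at hx
    change Tendsto _ _ _
    rw [Metric.tendsto_atTop]
    intro ε hε
    obtain ⟨y, hy, hxy⟩ := hx (ε / 2) (half_pos hε)
    obtain ⟨N, hN⟩ := Metric.tendsto_atTop.mp hy (ε / 2) (half_pos hε)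
    refine ⟨N, fun n hn => ?_⟩
    have h1 := hN n hn
    rw [dist_zero_right, norm_norm] at h1 ⊢
    have h2 : ‖x n - y n‖ ≤ ‖x - y‖ := lp.norm_apply_le_norm ENNReal.top_ne_zero (x - y) n
    rw [dist_eq_norm] at hxy
    calc ‖x n‖ = ‖(x n - y n) + y n‖ := by rw [sub_add_cancel]
      _ ≤ ‖x n - y n‖ + ‖y n‖ := norm_add_le _ _
      _ < ε := by linarith
  mul_mem_left' a x hx := by
    refine squeeze_zero (fun n => norm_nonneg _) (fun n => ?_) (g := fun n => ‖a‖ * ‖x n‖) ?_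
    · exact (norm_mul_le (a n) (x n)).trans
        (by gcongr; exact lp.norm_apply_le_norm ENNReal.top_ne_zero a n)
    · simpa using Tendsto.const_mul ‖a‖ hx
  mul_mem_right' a x hx := by
    refine squeeze_zero (fun n => norm_nonneg _) (fun n => ?_) (g := fun n => ‖x n‖ * ‖a‖) ?_
    · exact (norm_mul_le (x n) (a n)).trans
        (by gcongr; exact lp.norm_apply_le_norm ENNReal.top_ne_zero a n)
    · simpa using Tendsto.mul_const ‖a‖ hx

/-- The algebra of bounded sequences that are eventually of the form
`(…, x, t_n x, t_{n+1} t_n x, …)`. -/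
noncomputable def threadAlg (t : ∀ n, X n →⋆ₙₐ[ℂ] X (n + 1)) : NonUnitalStarSubalgebra ℂ (lp X ∞) where
  carrier := {x | ∃ N, ∀ n, N ≤ n → x (n + 1) = t n (x n)}
  add_mem' := by
    rintro x y ⟨N, hN⟩ ⟨M, hM⟩
    refine ⟨max N M, fun n hn => ?_⟩
    change x (n + 1) + y (n + 1) = t n (x n + y n)
    rw [hN n (le_of_max_le_left hn), hM n (le_of_max_le_right hn), map_add]
  zero_mem' := ⟨0, fun n _ => (map_zero (t n)).symm⟩
  mul_mem' := by
    rintro x y ⟨N, hN⟩ ⟨M, hM⟩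
    refine ⟨max N M, fun n hn => ?_⟩
    change x (n + 1) * y (n + 1) = t n (x n * y n)
    rw [hN n (le_of_max_le_left hn), hM n (le_of_max_le_right hn), map_mul]
  smul_mem' := by
    rintro c x ⟨N, hN⟩
    refine ⟨N, fun n hn => ?_⟩
    change c • x (n + 1) = t n (c • x n)
    rw [hN n hn, map_smul]
  star_mem' := by
    rintro x ⟨N, hN⟩
    refine ⟨N, fun n hn => ?_⟩
    change star (x (n + 1)) = t n (star (x n))
    rw [hN n hn, map_star]

/-- The C⋆-algebraic direct limit of a sequence `X 0 → X 1 → X 2 → …`, realised inside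
`∏ X n / ⨁ X n` as the closure of the union of the images of the natural maps
`X n ∋ x ↦ [(0, …, 0, x, t_n x, t_{n+1} t_n x, …)]`. -/
noncomputable def dirLimAlg (t : ∀ n, X n →⋆ₙₐ[ℂ] X (n + 1)) : NonUnitalStarSubalgebra ℂ (nullIdeal X).Quot :=
  ((threadAlg t).map (nullIdeal X).q).topologicalClosure

instance (t : ∀ n, X n →⋆ₙₐ[ℂ] X (n + 1)) : IsClosed (dirLimAlg t : Set (nullIdeal X).Quot) :=
  NonUnitalStarSubalgebra.isClosed_topologicalClosure _

theorem q_mem_dirLimAlg {t : ∀ n, X n →⋆ₙₐ[ℂ] X (n + 1)} {x : lp X ∞} (hx : x ∈ threadAlg t) :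
    (nullIdeal X).q x ∈ dirLimAlg t :=
  NonUnitalStarSubalgebra.le_topologicalClosure _ ⟨x, hx, rfl⟩

/-- The direct limit of a sequence `X 0 → X 1 → X 2 → …` of C⋆-algebras. -/
def DirLim (t : ∀ n, X n →⋆ₙₐ[ℂ] X (n + 1)) : Type _ := dirLimAlg t

noncomputable instance (t : ∀ n, X n →⋆ₙₐ[ℂ] X (n + 1)) : NonUnitalCStarAlgebra (DirLim t) :=
  inferInstanceAs (NonUnitalCStarAlgebra (dirLimAlg t))

/-- The homomorphism of `ℓ^∞`-products given by a sequence of homomorphisms. -/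
noncomputable def lpMap (b : ∀ n, X n →⋆ₙₐ[ℂ] X n) : lp X ∞ →⋆ₙₐ[ℂ] lp X ∞ where
  toFun x := toLp (fun n => b n (x n)) ‖x‖ fun n =>
    (NonUnitalStarAlgHom.norm_apply_le (b n) _).trans
      (lp.norm_apply_le_norm ENNReal.top_ne_zero x n)
  map_smul' c x := Subtype.ext (funext fun n => map_smul (b n) c (x n))
  map_zero' := Subtype.ext (funext fun n => map_zero (b n))
  map_add' x y := Subtype.ext (funext fun n => map_add (b n) (x n) (y n))
  map_mul' x y := Subtype.ext (funext fun n => map_mul (b n) (x n) (y n))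
  map_star' x := Subtype.ext (funext fun n => map_star (b n) (x n))

/-- The endomorphism of `∏ X n / ⨁ X n` given by a sequence of endomorphisms. -/
noncomputable def quotMap (b : ∀ n, X n →⋆ₙₐ[ℂ] X n) : (nullIdeal X).Quot →⋆ₙₐ[ℂ] (nullIdeal X).Quot :=
  ClosedIdeal.mapQ (nullIdeal X) (nullIdeal X) (lpMap b) fun _ hx =>
    squeeze_zero (fun _ => norm_nonneg _) (fun n => NonUnitalStarAlgHom.norm_apply_le (b n) _) hx

/-- The endomorphism of the direct limit induced by a compatible sequence of endomorphisms. -/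
noncomputable def dirLimMap (t : ∀ n, X n →⋆ₙₐ[ℂ] X (n + 1)) (b : ∀ n, X n →⋆ₙₐ[ℂ] X n)
    (h : ∀ n x, t n (b n x) = b (n + 1) (t n x)) : DirLim t →⋆ₙₐ[ℂ] DirLim t :=
  restrictHom (quotMap b) (dirLimAlg t) (dirLimAlg t) <| by
    have hcl : IsClosed (quotMap b ⁻¹' (dirLimAlg t : Set (nullIdeal X).Quot)) :=
      IsClosed.preimage
        (AddMonoidHomClass.continuous_of_bound (quotMap b) 1 fun x => by
          simpa only [one_mul] using NonUnitalStarAlgHom.norm_apply_le (quotMap b) x) inferInstance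
    refine fun x hx => closure_minimal ?_ hcl hx
    rintro _ ⟨x, ⟨N, hN⟩, rfl⟩
    refine q_mem_dirLimAlg ⟨N, fun n hn => ?_⟩
    change b (n + 1) (x (n + 1)) = t n (b n (x n))
    rw [hN n hn, h]

/-- The sequence `(x, t_0 x, t_1 t_0 x, …)`. -/
noncomputable def thread (t : ∀ n, X n →⋆ₙₐ[ℂ] X (n + 1)) : ∀ n, X 0 →⋆ₙₐ[ℂ] X n
  | 0 => NonUnitalStarAlgHom.id ℂ (X 0)
  | n + 1 => (t n).comp (thread t n)

/-- The natural homomorphism of the first algebra `X 0` to the direct limit. -/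
noncomputable def dirLimZero (t : ∀ n, X n →⋆ₙₐ[ℂ] X (n + 1)) : X 0 →⋆ₙₐ[ℂ] DirLim t where
  toFun x := ⟨(nullIdeal X).q
      (toLp (fun n => thread t n x) ‖x‖ fun n => NonUnitalStarAlgHom.norm_apply_le (thread t n) x),
    q_mem_dirLimAlg ⟨0, fun _ _ => rfl⟩⟩
  map_smul' c x := Subtype.ext <| congrArg (nullIdeal X).q <|
    Subtype.ext (funext fun n => map_smul (thread t n) c x)
  map_zero' := Subtype.ext <| congrArg (nullIdeal X).q <|
    Subtype.ext (funext fun n => map_zero (thread t n))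
  map_add' x y := Subtype.ext <| congrArg (nullIdeal X).q <|
    Subtype.ext (funext fun n => map_add (thread t n) x y)
  map_mul' x y := Subtype.ext <| congrArg (nullIdeal X).q <|
    Subtype.ext (funext fun n => map_mul (thread t n) x y)
  map_star' x := Subtype.ext <| congrArg (nullIdeal X).q <|
    Subtype.ext (funext fun n => map_star (thread t n) x)

end DirectLimit

section NaturalExtension

open scoped MultiplierAlgebra

variable {A : Type*} [NonUnitalCStarAlgebra A]

/-- The element `ᾱⁿ(1)` of `M(A)`. -/
noncomputable def unitImage (α : A →⋆ₙₐ[ℂ] A) (hα : Extendible α) (n : ℕ) : 𝓜(ℂ, A) :=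
  hα.ext^[n] 1

theorem isStarProjection_unitImage (α : A →⋆ₙₐ[ℂ] A) (hα : Extendible α) (n : ℕ) :
    IsStarProjection (unitImage α hα n) := by
  induction n with
  | zero => exact IsStarProjection.one _
  | succ n ih =>
    rw [unitImage, Function.iterate_succ_apply']
    exact ih.map hα.ext

/-- The algebra `A_n = ᾱⁿ(1) A ᾱⁿ(1)`. -/
noncomputable def cornerSeq (α : A →⋆ₙₐ[ℂ] A) (hα : Extendible α) (n : ℕ) :
    NonUnitalStarSubalgebra ℂ A :=
  corner (unitImage α hα n) (isStarProjection_unitImage α hα n)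

theorem unitImage_mul_succ (α : A →⋆ₙₐ[ℂ] A) (hα : Extendible α) (n : ℕ) :
    unitImage α hα n * unitImage α hα (n + 1) = unitImage α hα (n + 1) ∧
      unitImage α hα (n + 1) * unitImage α hα n = unitImage α hα (n + 1) := by
  induction n with
  | zero => exact ⟨one_mul _, mul_one _⟩
  | succ n ih =>
    simp only [unitImage, Function.iterate_succ_apply'] at ih ⊢
    rw [← map_mul, ← map_mul, ih.1, ih.2]
    exact ⟨rfl, rfl⟩

theorem cornerSeq_succ_le (α : A →⋆ₙₐ[ℂ] A) (hα : Extendible α) (n : ℕ) {a : A}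
    (ha : a ∈ cornerSeq α hα (n + 1)) : a ∈ cornerSeq α hα n := by
  obtain ⟨h1, h2⟩ := unitImage_mul_succ α hα n
  have e1 := congrArg (fun m : 𝓜(ℂ, A) => m.fst a) h1
  have e2 := congrArg (fun m : 𝓜(ℂ, A) => m.snd a) h2
  simp only [DoubleCentralizer.mul_fst, DoubleCentralizer.mul_snd,
    mul_apply_eq_comp, ha.1, ha.2] at e1 e2
  exact ⟨e1, e2⟩

theorem map_mem_cornerSeq (α : A →⋆ₙₐ[ℂ] A) (hα : Extendible α) (n : ℕ) {a : A}
    (ha : a ∈ cornerSeq α hα n) : α a ∈ cornerSeq α hα (n + 1) := by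
  refine ⟨?_, ?_⟩
  · rw [unitImage, Function.iterate_succ_apply', ← hα.map_fst]
    exact congrArg α ha.1
  · rw [unitImage, Function.iterate_succ_apply', ← hα.map_snd]
    exact congrArg α ha.2

/-- The algebra `B_n = q(A_0) ⊕ … ⊕ q(A_{n-1}) ⊕ A_n`, as a subalgebra of `(A/J)ⁿ ⊕ A`. -/
noncomputable def stageAlg (α : A →⋆ₙₐ[ℂ] A) (hα : Extendible α) (J : ClosedIdeal A) (n : ℕ) :
    NonUnitalStarSubalgebra ℂ ((Fin n → J.Quot) × A) where
  carrier := {x | (∀ k : Fin n, x.1 k ∈ (cornerSeq α hα k).map J.q) ∧ x.2 ∈ cornerSeq α hα n}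
  add_mem' hx hy := ⟨fun k => add_mem (hx.1 k) (hy.1 k), add_mem hx.2 hy.2⟩
  zero_mem' := ⟨fun _ => zero_mem _, zero_mem _⟩
  mul_mem' hx hy := ⟨fun k => mul_mem (hx.1 k) (hy.1 k), mul_mem hx.2 hy.2⟩
  smul_mem' c _ hx := ⟨fun k => SMulMemClass.smul_mem c (hx.1 k), SMulMemClass.smul_mem c hx.2⟩
  star_mem' hx := ⟨fun k => star_mem (hx.1 k), star_mem hx.2⟩

theorem mem_stageAlg {α : A →⋆ₙₐ[ℂ] A} {hα : Extendible α} {J : ClosedIdeal A} {n : ℕ}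
    {x : (Fin n → J.Quot) × A} : x ∈ stageAlg α hα J n ↔
      (∀ k : Fin n, x.1 k ∈ (cornerSeq α hα k).map J.q) ∧ x.2 ∈ cornerSeq α hα n := Iff.rfl

instance isClosed_stageAlg (α : A →⋆ₙₐ[ℂ] A) (hα : Extendible α) (J : ClosedIdeal A) (n : ℕ) :
    IsClosed (stageAlg α hα J n : Set ((Fin n → J.Quot) × A)) := by
  have e : (stageAlg α hα J n : Set ((Fin n → J.Quot) × A)) =
      (⋂ k : Fin n, (fun x : (Fin n → J.Quot) × A => x.1 k) ⁻¹'
        ((cornerSeq α hα k).map J.q : Set J.Quot)) ∩ Prod.snd ⁻¹' (cornerSeq α hα n : Set A) := by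
    ext x
    simp only [SetLike.mem_coe, mem_stageAlg, Set.mem_inter_iff, Set.mem_iInter, Set.mem_preimage]
  rw [e]
  refine IsClosed.inter (isClosed_iInter fun k => ?_) ?_
  · exact (isClosed_map_corner J _ _).preimage (by fun_prop)
  · exact (isClosed_corner _ _).preimage continuous_snd

/-- The C⋆-algebra `B_n`. -/
def Stage (α : A →⋆ₙₐ[ℂ] A) (hα : Extendible α) (J : ClosedIdeal A) (n : ℕ) : Type _ :=
  stageAlg α hα J n

noncomputable instance (α : A →⋆ₙₐ[ℂ] A) (hα : Extendible α) (J : ClosedIdeal A) (n : ℕ) :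
    NonUnitalCStarAlgebra (Stage α hα J n) :=
  inferInstanceAs (NonUnitalCStarAlgebra (stageAlg α hα J n))

/-- `(a_0, …, a_{n-1}, a_n) ↦ (a_0, …, a_{n-1}, q(a_n), α(a_n))` on the ambient algebras. -/
noncomputable def bondAmb (α : A →⋆ₙₐ[ℂ] A) (J : ClosedIdeal A) (n : ℕ) :
    (Fin n → J.Quot) × A →⋆ₙₐ[ℂ] (Fin (n + 1) → J.Quot) × A where
  toFun x := (Fin.snoc (α := fun _ => J.Quot) x.1 (J.q x.2), α x.2)
  map_smul' c x := Prod.ext (funext fun k => by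
    refine Fin.lastCases ?_ (fun i => ?_) k <;> simp) (map_smul α c x.2)
  map_zero' := Prod.ext (funext fun k => by
    refine Fin.lastCases ?_ (fun i => ?_) k <;> simp) (map_zero α)
  map_add' x y := Prod.ext (funext fun k => by
    refine Fin.lastCases ?_ (fun i => ?_) k <;> simp) (map_add α x.2 y.2)
  map_mul' x y := Prod.ext (funext fun k => by
    refine Fin.lastCases ?_ (fun i => ?_) k <;> simp) (map_mul α x.2 y.2)
  map_star' x := Prod.ext (funext fun k => by
    refine Fin.lastCases ?_ (fun i => ?_) k
    · simpa using map_star J.q x.2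
    · simp) (map_star α x.2)

/-- `(a_0, …, a_{n-1}, a_n) ↦ (a_1, …, a_{n-1}, q(a_n), α(a_n))` on the ambient algebra. -/
noncomputable def endoAmb (α : A →⋆ₙₐ[ℂ] A) (J : ClosedIdeal A) (n : ℕ) :
    (Fin n → J.Quot) × A →⋆ₙₐ[ℂ] (Fin n → J.Quot) × A where
  toFun x := (fun k => (bondAmb α J n x).1 k.succ, α x.2)
  map_smul' c x := Prod.ext (by rw [map_smul]; rfl) (map_smul α c x.2)
  map_zero' := Prod.ext (by rw [map_zero]; rfl) (map_zero α)
  map_add' x y := Prod.ext (by rw [map_add]; rfl) (map_add α x.2 y.2)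
  map_mul' x y := Prod.ext (by rw [map_mul]; rfl) (map_mul α x.2 y.2)
  map_star' x := Prod.ext (by rw [map_star]; rfl) (map_star α x.2)

theorem bondAmb_mem (α : A →⋆ₙₐ[ℂ] A) (hα : Extendible α) (J : ClosedIdeal A) (n : ℕ)
    (x : (Fin n → J.Quot) × A) (hx : x ∈ stageAlg α hα J n) :
    bondAmb α J n x ∈ stageAlg α hα J (n + 1) := by
  refine ⟨fun k => ?_, map_mem_cornerSeq α hα n hx.2⟩
  refine Fin.lastCases ?_ (fun i => ?_) k
  · exact ⟨x.2, hx.2, by simp [bondAmb]; rfl⟩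
  · have := hx.1 i
    simpa [bondAmb] using this

theorem endoAmb_mem (α : A →⋆ₙₐ[ℂ] A) (hα : Extendible α) (J : ClosedIdeal A) (n : ℕ)
    (x : (Fin n → J.Quot) × A) (hx : x ∈ stageAlg α hα J n) :
    endoAmb α J n x ∈ stageAlg α hα J n := by
  have h := bondAmb_mem α hα J n x hx
  refine ⟨fun k => ?_, cornerSeq_succ_le α hα n h.2⟩
  obtain ⟨a, ha, e⟩ := h.1 k.succ
  exact ⟨a, cornerSeq_succ_le α hα k ha, e⟩

/-- The bonding homomorphism `T_n : B_n → B_{n+1}`. -/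
noncomputable def bond (α : A →⋆ₙₐ[ℂ] A) (hα : Extendible α) (J : ClosedIdeal A) (n : ℕ) :
    Stage α hα J n →⋆ₙₐ[ℂ] Stage α hα J (n + 1) :=
  restrictHom (bondAmb α J n) (stageAlg α hα J n) (stageAlg α hα J (n + 1))
    (bondAmb_mem α hα J n)

/-- The endomorphism `β_n : B_n → B_n`. -/
noncomputable def stageEndo (α : A →⋆ₙₐ[ℂ] A) (hα : Extendible α) (J : ClosedIdeal A) (n : ℕ) :
    Stage α hα J n →⋆ₙₐ[ℂ] Stage α hα J n :=
  restrictHom (endoAmb α J n) (stageAlg α hα J n) (stageAlg α hα J n)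
    (endoAmb_mem α hα J n)

theorem bond_stageEndo (α : A →⋆ₙₐ[ℂ] A) (hα : Extendible α) (J : ClosedIdeal A) (n : ℕ)
    (x : Stage α hα J n) :
    bond α hα J n (stageEndo α hα J n x) = stageEndo α hα J (n + 1) (bond α hα J n x) := by
  refine Subtype.ext (Prod.ext (funext fun k => ?_) rfl)
  obtain ⟨⟨x, a⟩, hx⟩ := x
  change (bondAmb α J n (endoAmb α J n (x, a))).1 k =
    (bondAmb α J (n + 1) (bondAmb α J n (x, a))).1 k.succ
  refine Fin.lastCases ?_ (fun i => ?_) k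
  · simp [bondAmb, endoAmb]
  · simp [bondAmb, endoAmb, -Fin.castSucc_succ, Fin.succ_castSucc]

/-- The C⋆-algebra `B`: the direct limit of `B_0 → B_1 → B_2 → …`. -/
def NatExt (α : A →⋆ₙₐ[ℂ] A) (hα : Extendible α) (J : ClosedIdeal A) : Type _ :=
  DirLim (X := fun n => Stage α hα J n) (bond α hα J)

noncomputable instance (α : A →⋆ₙₐ[ℂ] A) (hα : Extendible α) (J : ClosedIdeal A) :
    NonUnitalCStarAlgebra (NatExt α hα J) :=
  inferInstanceAs (NonUnitalCStarAlgebra (DirLim (X := fun n => Stage α hα J n) (bond α hα J)))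

/-- The endomorphism `β` of `B` induced by the endomorphisms `β_n`. -/
noncomputable def natEndo (α : A →⋆ₙₐ[ℂ] A) (hα : Extendible α) (J : ClosedIdeal A) :
    NatExt α hα J →⋆ₙₐ[ℂ] NatExt α hα J :=
  dirLimMap (X := fun n => Stage α hα J n) (bond α hα J) (stageEndo α hα J)
    (bond_stageEndo α hα J)

/-- The identification of `A` with `B_0`. -/
noncomputable def toStageZero (α : A →⋆ₙₐ[ℂ] A) (hα : Extendible α) (J : ClosedIdeal A) :
    A →⋆ₙₐ[ℂ] Stage α hα J 0 where
  toFun a := ⟨(Fin.elim0, a), fun k => k.elim0, rfl, rfl⟩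
  map_smul' _ _ := Subtype.ext (Prod.ext (Subsingleton.elim _ _) rfl)
  map_zero' := Subtype.ext (Prod.ext (Subsingleton.elim _ _) rfl)
  map_add' _ _ := Subtype.ext (Prod.ext (Subsingleton.elim _ _) rfl)
  map_mul' _ _ := Subtype.ext (Prod.ext (Subsingleton.elim _ _) rfl)
  map_star' _ := Subtype.ext (Prod.ext (Subsingleton.elim _ _) rfl)

/-- The natural homomorphism `T : A = B_0 → B`. -/
noncomputable def natEmb (α : A →⋆ₙₐ[ℂ] A) (hα : Extendible α) (J : ClosedIdeal A) :
    A →⋆ₙₐ[ℂ] NatExt α hα J :=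
  (dirLimZero (X := fun n => Stage α hα J n) (bond α hα J)).comp (toStageZero α hα J)

end NaturalExtension

section Systems

open scoped MultiplierAlgebra

variable {A B : Type*} [NonUnitalCStarAlgebra A] [NonUnitalCStarAlgebra B]

/-- A complete transfer operator for the C⋆-dynamical system `(A, α)`: a positive linear map `L`
with `L(α(a)b) = a L(b)` and `α(L(a)) = ᾱ(1) a ᾱ(1)`. -/
structure IsCompleteTransferOperator (α : A →⋆ₙₐ[ℂ] A) (hα : Extendible α) (L : A →ₗ[ℂ] A) :
    Prop where
  positive : ∀ a : A, ∃ b : A, L (star a * a) = star b * b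
  transfer : ∀ a b : A, L (α a * b) = a * L b
  complete : ∀ a : A, α (L a) = (hα.ext 1).fst ((hα.ext 1).snd a)

/-- `(A, α)` is a reversible C⋆-dynamical system: `α` is extendible and admits a complete
transfer operator. -/
def IsReversible (α : A →⋆ₙₐ[ℂ] A) : Prop :=
  ∃ (hα : Extendible α) (L : A →ₗ[ℂ] A), IsCompleteTransferOperator α hα L

/-- The annihilator `(ker α)^⊥ = {a : a ker α = 0}`. -/
def kerPerp (α : A →⋆ₙₐ[ℂ] A) : Set A := {a | ∀ c : A, α c = 0 → a * c = 0}

/-- A morphism of C⋆-dynamical systems: a non-degenerate (`T(A)B` is total in `B`) homomorphism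
with `T ∘ α = β ∘ T`. -/
structure IsMorphism (α : A →⋆ₙₐ[ℂ] A) (β : B →⋆ₙₐ[ℂ] B) (T : A →⋆ₙₐ[ℂ] B) : Prop where
  nondegenerate : (Submodule.span ℂ {x : B | ∃ a b, x = T a * b}).topologicalClosure = ⊤
  commutes : ∀ a, T (α a) = β (T a)

/-- An embedding of `(A, α)` into `(B, β)`, i.e. `(B, β)` is an extension of `(A, α)`. -/
structure IsEmbedding (α : A →⋆ₙₐ[ℂ] A) (β : B →⋆ₙₐ[ℂ] B) (T : A →⋆ₙₐ[ℂ] B) : Prop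
    extends IsMorphism α β T where
  injective : Function.Injective T

/-- A `J`-covariant embedding of `(A, α)` into `(B, β)`: `J = T⁻¹((ker β)^⊥)`. -/
structure IsCovariantEmbeddingOn (α : A →⋆ₙₐ[ℂ] A) (J : Set A) (β : B →⋆ₙₐ[ℂ] B)
    (T : A →⋆ₙₐ[ℂ] B) : Prop extends IsEmbedding α β T where
  preimage_eq : J = T ⁻¹' kerPerp β

/-- A covariant embedding of `(A, α)` into `(B, β)`: the case `J = (ker α)^⊥`. -/
def IsCovariantEmbedding (α : A →⋆ₙₐ[ℂ] A) (β : B →⋆ₙₐ[ℂ] B) (T : A →⋆ₙₐ[ℂ] B) : Prop :=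
  IsCovariantEmbeddingOn α (kerPerp α) β T

/-- `(B, β)`, with the embedding `T`, is a reversible `J`-extension of `(A, α)`. -/
structure IsReversibleExtension (α : A →⋆ₙₐ[ℂ] A) (J : Set A) (β : B →⋆ₙₐ[ℂ] B)
    (T : A →⋆ₙₐ[ℂ] B) : Prop where
  reversible : IsReversible β
  embedding : IsCovariantEmbeddingOn α J β T

/-- `B = ∑ₙ β_*ⁿ(T(A))` (closed linear span) and `J = {a : β̄_*(1) T(a) = T(a)}`, where `β_*` is
the complete transfer operator of `(B, β)` and `β̄_*` is its strictly continuous extension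
to `M(B)`. -/
def IsGeneratedBy (J : Set A) (β : B →⋆ₙₐ[ℂ] B) (T : A →⋆ₙₐ[ℂ] B) : Prop :=
  ∃ (hβ : Extendible β) (L : B →ₗ[ℂ] B) (Lbar : 𝓜(ℂ, B) → 𝓜(ℂ, B)),
    IsCompleteTransferOperator β hβ L ∧ IsStrictExtension L Lbar ∧
    (Submodule.span ℂ {b : B | ∃ (n : ℕ) (a : A), b = L^[n] (T a)}).topologicalClosure = ⊤ ∧
    J = {a | (Lbar 1).fst (T a) = T a}

/-- Every reversible `J`-extension `(D, δ)` of `(A, α)` with embedding `R` receives a unique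
covariant embedding `Φ` from `(B, β)` with `R = Φ ∘ T`. -/
def IsUniversalExtension.{w, u, v} {A : Type u} {B : Type v} [NonUnitalCStarAlgebra A]
    [NonUnitalCStarAlgebra B] (α : A →⋆ₙₐ[ℂ] A) (J : Set A) (β : B →⋆ₙₐ[ℂ] B)
    (T : A →⋆ₙₐ[ℂ] B) : Prop :=
  ∀ (D : Type w) [NonUnitalCStarAlgebra D] (δ : D →⋆ₙₐ[ℂ] D) (R : A →⋆ₙₐ[ℂ] D),
    IsReversibleExtension α J δ R →
      ∃! Φ : B →⋆ₙₐ[ℂ] D, IsCovariantEmbedding β δ Φ ∧ Φ.comp T = R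

end Systems

end CStarDyn

open CStarDyn

universe u v

/-!
The idea is to describe `B` by generators. For `a` in `A_n`, write `gen n a` for the class in `B`
of `0 ⊕ … ⊕ 0 ⊕ a` in `B_n`. Since `T_n` maps `0 ⊕ … ⊕ 0 ⊕ a` to `0 ⊕ … ⊕ q(a) ⊕ α(a)`,
the elements `gen n a` span a dense subspace of `B` (`natExt_induction`); they satisfy `gen 0 = T`,
`β (gen (n + 1) a) = gen n a` and `T(v) gen n a = gen n (αⁿ(v) a)`. The last relation shows that the
images `β(T(u))` of an approximate unit converge strongly on `B`. A homomorphism with this property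
is extendible (`extendible_of_hasFactor`); its extension `f̄(m) : f(a) z ↦ f(m a) z` is strictly
continuous on all of `M(A)`, not only on bounded sets, by the Cohen factorization theorem
(`exists_factorization`).

A complete transfer operator is the inverse of the isometry `β : (ker β)^⊥ → β̄(1) B β̄(1)`,
preceded by compression to the corner (`exists_completeTransferOperator`), so that only
surjectivity of this isometry has to be proved, and this may be checked on generators: `gen (n + 1) a` is mapped to
`gen n a`. It is in `(ker β)^⊥` because `β` and the zeroth coordinate `B → A/J` are jointly
injective, as together they make up the injective bonding maps (`endoSlot_injective`). It follows
that `gen n a = β_*ⁿ(T(a))`, which gives (i).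

For (ii), let `S` be a `J`-embedding into a reversible system `(C, γ)`. An element `c` of `C` is
determined by the classes of `c, γ(c), …, γ^{n-1}(c)` modulo `(ker γ)^⊥`, together with `γⁿ(c)`
(`components_injective`). Prescribing these components by `S` defines an injective homomorphism
`B_n → C`, and in the limit the embedding `natLift` of `B`, with `gen n a ↦ γ_*ⁿ(S(a))`.
It is unique since covariant embeddings intertwine transfer operators
(`IsCovariantEmbedding.map_transfer`). Part (iii) is formal: under the property in (i) the range
of `natLift` is closed and contains a dense subspace, and under the property in (ii) the two
comparison embeddings are mutually inverse.
-/

namespace CStarDyn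

open Filter Topology
open scoped MultiplierAlgebra CStarAlgebra ENNReal

/-! ### Approximate units and factorization -/

section ApproxUnit

variable {A B : Type*} [NonUnitalCStarAlgebra A] [NonUnitalCStarAlgebra B]

theorem norm_map_le (f : A →⋆ₙₐ[ℂ] B) (a : A) : ‖f a‖ ≤ ‖a‖ :=
  NonUnitalStarAlgHom.norm_apply_le f a

theorem continuous_hom (f : A →⋆ₙₐ[ℂ] B) : Continuous f :=
  AddMonoidHomClass.continuous_of_bound f 1 fun x => by
    simpa only [one_mul] using norm_map_le f x

/-- The canonical increasing approximate unit of a C⋆-algebra, as a filter. -/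
noncomputable def approxUnit (A : Type*) [NonUnitalCStarAlgebra A] : Filter A :=
  let := CStarAlgebra.spectralOrder A
  have := CStarAlgebra.spectralOrderedRing A
  CStarAlgebra.approximateUnit A

instance : (approxUnit A).NeBot := by
  let := CStarAlgebra.spectralOrder A
  have := CStarAlgebra.spectralOrderedRing A
  exact (CStarAlgebra.increasingApproximateUnit A).neBot

theorem approxUnit_norm : ∀ᶠ u in approxUnit A, ‖u‖ ≤ 1 := by
  let := CStarAlgebra.spectralOrder A
  have := CStarAlgebra.spectralOrderedRing A
  exact (CStarAlgebra.increasingApproximateUnit A).eventually_norm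

theorem approxUnit_pos : ∀ᶠ u in approxUnit A, ∃ v, u = star v * v := by
  let := CStarAlgebra.spectralOrder A
  have := CStarAlgebra.spectralOrderedRing A
  exact (CStarAlgebra.increasingApproximateUnit A).eventually_nonneg.mono fun u hu =>
    CStarAlgebra.nonneg_iff_eq_star_mul_self.mp hu

theorem approxUnit_mul (a : A) : Tendsto (fun u => u * a) (approxUnit A) (𝓝 a) := by
  let := CStarAlgebra.spectralOrder A
  have := CStarAlgebra.spectralOrderedRing A
  exact (CStarAlgebra.increasingApproximateUnit A).tendsto_mul_right a

theorem mul_approxUnit (a : A) : Tendsto (fun u => a * u) (approxUnit A) (𝓝 a) := by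
  let := CStarAlgebra.spectralOrder A
  have := CStarAlgebra.spectralOrderedRing A
  exact (CStarAlgebra.increasingApproximateUnit A).tendsto_mul_left a

theorem approxUnit_star : ∀ᶠ u in approxUnit A, star u = u :=
  approxUnit_pos.mono fun u ⟨v, hv⟩ => by rw [hv, star_mul, star_star]

/-- A positive element `z`, perturbed by `c > 0`, is invertible in the unitization, and the
inverse has norm at most `c⁻¹`. -/
theorem exists_resolvent [PartialOrder B] [StarOrderedRing B] {c : ℝ} (hc : 0 < c) {z : B}
    (hz : 0 ≤ z) (x : B) : ∃ y : B, c • y + z * y = x ∧ ‖y‖ ≤ c⁻¹ * ‖x‖ := by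
  let := CStarAlgebra.spectralOrder (B⁺¹)
  have := CStarAlgebra.spectralOrderedRing (B⁺¹)
  have hz' : (0 : B⁺¹) ≤ (z : B⁺¹) := Unitization.inr_nonneg_iff.mpr hz
  have hzs : IsSelfAdjoint (z : B⁺¹) := IsSelfAdjoint.of_nonneg hz'
  have hpos : ∀ t ∈ spectrum ℝ (z : B⁺¹), 0 < c + t := fun t ht => by
    have := spectrum_nonneg_of_nonneg hz' ht
    linarith
  have hcont : ContinuousOn (fun t : ℝ => (c + t)⁻¹) (spectrum ℝ (z : B⁺¹)) :=
    ContinuousOn.inv₀ (by fun_prop) fun t ht => (hpos t ht).ne'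
  set w : B⁺¹ := cfc (fun t : ℝ => (c + t)⁻¹) (z : B⁺¹) with hw
  have hw1 : ‖w‖ ≤ c⁻¹ := norm_cfc_le (by positivity) fun t ht => by
    have h1 := spectrum_nonneg_of_nonneg hz' ht
    rw [Real.norm_of_nonneg (inv_nonneg.mpr (hpos t ht).le)]
    exact inv_anti₀ hc (by linarith)
  have hw2 : (algebraMap ℝ (B⁺¹) c + (z : B⁺¹)) * w = 1 := by
    have e : algebraMap ℝ (B⁺¹) c + (z : B⁺¹) = cfc (fun t : ℝ => c + t) (z : B⁺¹) := by
      rw [cfc_const_add c (fun t => t) (z : B⁺¹), cfc_id' ℝ (z : B⁺¹)]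
    rw [e, hw, ← cfc_mul (fun t : ℝ => c + t) (fun t : ℝ => (c + t)⁻¹) _ (by fun_prop) hcont,
      ← cfc_one ℝ (z : B⁺¹)]
    exact cfc_congr fun t ht => mul_inv_cancel₀ (hpos t ht).ne'
  have hy : ((w * (x : B⁺¹)).snd : B⁺¹) = w * (x : B⁺¹) :=
    Unitization.ext (by simp) (by simp)
  refine ⟨(w * (x : B⁺¹)).snd, ?_, ?_⟩
  · have h := congrArg (· * (x : B⁺¹)) hw2
    simp only [mul_assoc, one_mul, add_mul] at h
    rw [← hy] at h
    apply Unitization.inr_injective (R := ℂ)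
    simpa [Algebra.algebraMap_eq_smul_one] using h
  · rw [← Unitization.norm_inr (𝕜 := ℂ), hy, ← Unitization.norm_inr (𝕜 := ℂ) (a := x)]
    exact (norm_mul_le _ _).trans (by gcongr)

/-- One step of the Cohen factorization: halving `c` in `x = c y + f(s) y`. -/
theorem cohen_step [PartialOrder B] [StarOrderedRing B] (f : A →⋆ₙₐ[ℂ] B) {x : B}
    (hx : Tendsto (fun u => f u * x) (approxUnit A) (𝓝 x)) {c : ℝ} (hc : 0 < c) {s : A} {y : B}
    (hs : 0 ≤ f s) (hxy : c • y + f s * y = x) :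
    ∃ (s' : A) (y' : B), 0 ≤ f s' ∧ (c / 2) • y' + f s' * y' = x ∧ ‖s' - s‖ ≤ c / 2 ∧
      ‖y' - y‖ ≤ c / 2 := by
  have hy : Tendsto (fun u => f u * y) (approxUnit A) (𝓝 y) := by
    have e : ∀ b : B, b = x → c⁻¹ • (b - f s * y) = y := fun b hb => by
      rw [hb, ← hxy, add_sub_cancel_right, smul_smul, inv_mul_cancel₀ hc.ne', one_smul]
    have h1 : Tendsto (fun u => f (u * s)) (approxUnit A) (𝓝 (f s)) :=
      ((continuous_hom f).tendsto _).comp (approxUnit_mul s)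
    have h2 := (hx.sub (h1.mul_const y)).const_smul c⁻¹
    rw [e x rfl] at h2
    refine h2.congr fun u => ?_
    rw [map_mul, mul_assoc, ← mul_sub, ← mul_smul_comm, e x rfl]
  have h3 : ∀ᶠ u in approxUnit A, ‖f u * y - y‖ < c / 2 := by
    have := hy.eventually (Metric.ball_mem_nhds y (half_pos hc))
    simpa only [Metric.mem_ball, dist_eq_norm] using this
  obtain ⟨u, h4, h5, v, hv⟩ := (h3.and (approxUnit_norm.and approxUnit_pos)).exists
  have hfu : 0 ≤ f u := by
    rw [hv, map_mul, map_star]; exact star_mul_self_nonneg _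
  have hs' : 0 ≤ f (s + (c / 2) • u) := by
    have e : (c / 2) • u = ((c / 2 : ℝ) : ℂ) • u := (Complex.coe_smul _ _).symm
    rw [map_add, e, map_smul, Complex.coe_smul]
    exact add_nonneg hs (smul_nonneg (half_pos hc).le hfu)
  obtain ⟨d, hd, hd'⟩ := exists_resolvent (half_pos hc) hs' ((c / 2) • (y - f u * y))
  refine ⟨s + (c / 2) • u, y + d, hs', ?_, ?_, ?_⟩
  · have e : f (s + (c / 2) • u) = f s + (c / 2) • f u := by
      have e : (c / 2) • u = ((c / 2 : ℝ) : ℂ) • u := (Complex.coe_smul _ _).symm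
      rw [map_add, e, map_smul, Complex.coe_smul]
    have e2 : (c / 2) • (y + d) + f (s + (c / 2) • u) * (y + d) =
        ((c / 2) • y + (f s + (c / 2) • f u) * y) +
          ((c / 2) • d + f (s + (c / 2) • u) * d) := by
      rw [← e, smul_add, mul_add]; abel
    have e3 : c • y = (c / 2) • y + (c / 2) • y := by rw [← add_smul, add_halves]
    rw [e2, hd, ← hxy, e3, add_mul, smul_mul_assoc, smul_sub]
    abel
  · rw [add_sub_cancel_left, norm_smul, Real.norm_of_nonneg (half_pos hc).le]
    exact mul_le_of_le_one_right (half_pos hc).le h5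
  · rw [add_sub_cancel_left]
    refine hd'.trans ?_
    rw [norm_smul, Real.norm_of_nonneg (half_pos hc).le, ← mul_assoc,
      inv_mul_cancel₀ (half_pos hc).ne', one_mul, ← norm_neg, neg_sub]
    exact h4.le

/-- Cohen factorization for the left action of `A` on `B` given by a homomorphism `A → B`. -/
theorem exists_factorization (f : A →⋆ₙₐ[ℂ] B) {x : B}
    (hx : Tendsto (fun u => f u * x) (approxUnit A) (𝓝 x)) : ∃ (a : A) (y : B), f a * y = x := by
  let := CStarAlgebra.spectralOrder B
  have := CStarAlgebra.spectralOrderedRing B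
  -- The solutions `(s, y)` of `x = 2⁻ⁿ y + f(s) y` produced by halving `c` are Cauchy sequences,
  -- and the first term vanishes in the limit.
  let S : ℕ → Type _ := fun n =>
    {z : A × B // 0 ≤ f z.1 ∧ ((1 : ℝ) / 2 ^ n) • z.2 + f z.1 * z.2 = x}
  have step : ∀ n (z : S n), ∃ z' : S (n + 1), ‖z'.1.1 - z.1.1‖ ≤ 1 / 2 / 2 ^ n ∧
      ‖z'.1.2 - z.1.2‖ ≤ 1 / 2 / 2 ^ n := fun n z => by
    obtain ⟨s', y', h1, h2, h3, h4⟩ := cohen_step f hx (c := 1 / 2 ^ n) (by positivity) z.2.1 z.2.2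
    have e : (1 : ℝ) / 2 ^ n / 2 = 1 / 2 ^ (n + 1) := by rw [pow_succ, div_div]
    have e' : (1 : ℝ) / 2 ^ n / 2 = 1 / 2 / 2 ^ n := div_right_comm _ _ _
    exact ⟨⟨(s', y'), h1, by rw [← e]; exact h2⟩, e' ▸ h3, e' ▸ h4⟩
  choose next hn1 hn2 using step
  let z : ∀ n, S n := fun n => Nat.rec ⟨(0, x), by simp, by simp⟩ next n
  have c1 : CauchySeq fun n => (z n).1.1 := cauchySeq_of_le_geometric_two (C := 1) fun n => by
    rw [dist_eq_norm, ← norm_neg, neg_sub]; exact hn1 n (z n)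
  have c2 : CauchySeq fun n => (z n).1.2 := cauchySeq_of_le_geometric_two (C := 1) fun n => by
    rw [dist_eq_norm, ← norm_neg, neg_sub]; exact hn2 n (z n)
  obtain ⟨a, ha⟩ := cauchySeq_tendsto_of_complete c1
  obtain ⟨y, hy⟩ := cauchySeq_tendsto_of_complete c2
  refine ⟨a, y, ?_⟩
  have h0 : Tendsto (fun n : ℕ => (1 : ℝ) / 2 ^ n) atTop (𝓝 0) := by
    simpa using tendsto_pow_atTop_nhds_zero_of_lt_one (r := (1 / 2 : ℝ)) (by norm_num) (by norm_num)
  have h1 := (h0.smul hy).add ((((continuous_hom f).tendsto _).comp ha).mul hy)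
  rw [zero_smul, zero_add] at h1
  exact tendsto_nhds_unique h1 ((tendsto_const_nhds (x := x)).congr fun n => ((z n).2.2).symm)

end ApproxUnit

/-! ### Strict convergence and extendible homomorphisms -/

section Strict

variable {A B : Type*} [NonUnitalCStarAlgebra A] [NonUnitalCStarAlgebra B]

theorem tendsto_strict_iff {ι : Type*} {l : Filter ι} {g : ι → 𝓜(ℂ, A)} {m : 𝓜(ℂ, A)} :
    Tendsto g l (@nhds _ (strictTopology A) m) ↔
      (∀ b, Tendsto (fun i => (g i).fst b) l (𝓝 (m.fst b))) ∧
        ∀ b, Tendsto (fun i => (g i).snd b) l (𝓝 (m.snd b)) := by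
  rw [nhds_induced, tendsto_comap_iff, nhds_prod_eq, tendsto_prod_iff', tendsto_pi_nhds,
    tendsto_pi_nhds]
  rfl

theorem continuous_strict_pair (A : Type*) [NonUnitalCStarAlgebra A] :
    @Continuous _ _ (strictTopology A) _ fun m : 𝓜(ℂ, A) =>
      ((fun a => m.fst a, fun a => m.snd a) : (A → A) × (A → A)) :=
  continuous_induced_dom

/-- Strict convergence of elements `e i` of `A` to a multiplier `m`. -/
structure StrictTendsto {ι : Type*} (e : ι → A) (l : Filter ι) (m : 𝓜(ℂ, A)) : Prop where
  left : ∀ b, Tendsto (fun i => e i * b) l (𝓝 (m.fst b))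
  right : ∀ b, Tendsto (fun i => b * e i) l (𝓝 (m.snd b))

theorem strictTendsto_iff {ι : Type*} {e : ι → A} {l : Filter ι} {m : 𝓜(ℂ, A)} :
    StrictTendsto e l m ↔
      Tendsto (fun i => DoubleCentralizer.coe ℂ (e i)) l (@nhds _ (strictTopology A) m) := by
  rw [tendsto_strict_iff]
  exact ⟨fun h => ⟨h.left, h.right⟩, fun h => ⟨h.1, h.2⟩⟩

theorem strictTendsto_approxUnit : StrictTendsto (fun u : A => u) (approxUnit A) 1 :=
  ⟨approxUnit_mul, mul_approxUnit⟩

theorem IsStrictExtension.strictTendsto {f : A → B} {F : 𝓜(ℂ, A) → 𝓜(ℂ, B)}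
    (hF : IsStrictExtension f F) {ι : Type*} {e : ι → A} {l : Filter ι} {m : 𝓜(ℂ, A)}
    (h : StrictTendsto e l m) : StrictTendsto (fun i => f (e i)) l (F m) := by
  rw [strictTendsto_iff] at h ⊢
  have := (@Continuous.tendsto _ _ (strictTopology A) (strictTopology B) F hF.continuous m).comp h
  exact this.congr fun i => hF.extends_apply (e i)

theorem StrictTendsto.iterate {α : A →⋆ₙₐ[ℂ] A} (hα : Extendible α) {ι : Type*} {e : ι → A}
    {l : Filter ι} (h : StrictTendsto e l 1) (n : ℕ) :
    StrictTendsto (fun i => α^[n] (e i)) l (unitImage α hα n) := by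
  induction n with
  | zero => exact h
  | succ n ih =>
    rw [unitImage, Function.iterate_succ_apply']
    simp only [Function.iterate_succ_apply']
    exact hα.ext_spec.strictTendsto ih

theorem isClosed_setOf_fixed (f : A →⋆ₙₐ[ℂ] B) :
    IsClosed {y : B | Tendsto (fun u => f u * y) (approxUnit A) (𝓝 y)} := by
  refine isClosed_of_closure_subset fun y hy => ?_
  rw [Metric.mem_closure_iff] at hy
  rw [Set.mem_ofPred_eq, Metric.tendsto_nhds]
  intro ε hε
  obtain ⟨x, hx, hxy⟩ := hy (ε / 3) (by positivity)
  filter_upwards [Metric.tendsto_nhds.mp hx (ε / 3) (by positivity), approxUnit_norm] with u h1 h2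
  have h3 : ‖f u‖ ≤ 1 := (norm_map_le f u).trans h2
  have h4 : dist (f u * y) (f u * x) ≤ dist y x := by
    rw [dist_eq_norm, dist_eq_norm, ← mul_sub]
    exact (norm_mul_le _ _).trans (mul_le_of_le_one_left (norm_nonneg _) h3)
  calc dist (f u * y) y ≤ dist (f u * y) (f u * x) + dist (f u * x) x + dist x y :=
        dist_triangle4 _ _ _ _
    _ < ε := by rw [dist_comm x y]; linarith

/-- If the images under `f` of a right approximate unit converge strongly, then every `b`
decomposes as `f(a) y` plus a vector killed by `f(A)`. -/
theorem exists_factor_of_tendsto (f : A →⋆ₙₐ[ℂ] B) {ι : Type*} {e : ι → A} {l : Filter ι} [l.NeBot]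
    (he : ∀ a, Tendsto (fun i => a * e i) l (𝓝 a)) {b y : B}
    (hy : Tendsto (fun i => f (e i) * b) l (𝓝 y)) :
    ∃ (a : A) (z : B), ∀ c, f c * (f a * z) = f c * b := by
  have h1 : Tendsto (fun u => f u * y) (approxUnit A) (𝓝 y) := by
    refine (isClosed_setOf_fixed f).mem_of_tendsto hy (Eventually.of_forall fun i => ?_)
    have := (((continuous_hom f).tendsto _).comp (approxUnit_mul (e i))).mul_const b
    exact this.congr fun u => by simp [mul_assoc]
  obtain ⟨a, z, h⟩ := exists_factorization f h1
  refine ⟨a, z, fun c => ?_⟩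
  rw [h]
  refine tendsto_nhds_unique (hy.const_mul (f c)) ?_
  have := (((continuous_hom f).tendsto _).comp (he c)).mul_const b
  exact this.congr fun u => by simp [mul_assoc]

section Extension

variable {f : A →⋆ₙₐ[ℂ] B}

/-- `f(A)` acts on `b` as on some `f(a) z`. -/
def HasFactor (f : A →⋆ₙₐ[ℂ] B) (b : B) (a : A) (z : B) : Prop :=
  ∀ c, f c * (f a * z) = f c * b

theorem HasFactor.tendsto {b z : B} {a : A} (h : HasFactor f b a z) (m : 𝓜(ℂ, A)) :
    Tendsto (fun u => f (m.snd u) * b) (approxUnit A) (𝓝 (f (m.fst a) * z)) := by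
  have := (((continuous_hom f).tendsto _).comp (approxUnit_mul (m.fst a))).mul_const z
  refine this.congr fun u => ?_
  rw [← h, ← mul_assoc, ← map_mul, m.central]; rfl

theorem HasFactor.eq {b z z' : B} {a a' : A} (h : HasFactor f b a z) (h' : HasFactor f b a' z')
    (m : 𝓜(ℂ, A)) : f (m.fst a) * z = f (m.fst a') * z' :=
  tendsto_nhds_unique (h.tendsto m) (h'.tendsto m)

variable (H : ∀ b, ∃ (a : A) (z : B), HasFactor f b a z)

/-- The action of `f̄(m)` on `B`: a multiplier `m` sends `f(a) z` to `f(m a) z`. -/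
noncomputable def extAct (m : 𝓜(ℂ, A)) (b : B) : B :=
  f (m.fst (H b).choose) * (H b).choose_spec.choose

theorem extAct_eq {b z : B} {a : A} (h : HasFactor f b a z) (m : 𝓜(ℂ, A)) :
    extAct H m b = f (m.fst a) * z :=
  HasFactor.eq (H b).choose_spec.choose_spec h m

theorem extAct_tendsto (m : 𝓜(ℂ, A)) (b : B) :
    Tendsto (fun u => f (m.snd u) * b) (approxUnit A) (𝓝 (extAct H m b)) :=
  HasFactor.tendsto (H b).choose_spec.choose_spec m

theorem extAct_mul (m n : 𝓜(ℂ, A)) (b : B) : extAct H (m * n) b = extAct H m (extAct H n b) := by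
  obtain ⟨a, z, h⟩ := H b
  rw [extAct_eq H h, extAct_eq H h, extAct_eq H (a := n.fst a) (z := z) fun c => rfl]
  rfl

theorem extAct_norm_le (m : 𝓜(ℂ, A)) (b : B) : ‖extAct H m b‖ ≤ ‖m‖ * ‖b‖ := by
  refine le_of_tendsto (extAct_tendsto H m b).norm ?_
  filter_upwards [approxUnit_norm] with u hu
  refine (norm_mul_le _ _).trans ?_
  gcongr
  refine (norm_map_le f _).trans ((m.snd.le_opNorm u).trans ?_)
  rw [DoubleCentralizer.norm_snd]
  exact mul_le_of_le_one_right (norm_nonneg _) hu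

theorem extAct_central (m : 𝓜(ℂ, A)) (x y : B) :
    star (extAct H (star m) (star x)) * y = x * extAct H m y := by
  have h1 := ((extAct_tendsto H (star m) (star x)).star).mul_const y
  refine tendsto_nhds_unique h1 ?_
  obtain ⟨a, z, h⟩ := H y
  rw [extAct_eq H h]
  have h2 : Tendsto (fun u => star u * a) (approxUnit A) (𝓝 a) := by
    have := (mul_approxUnit (star a)).star
    simpa using (approxUnit_mul a).congr' (approxUnit_star.mono fun u hu => by rw [hu])
  have h3 := ((((continuous_hom f).comp m.fst.continuous).tendsto _).comp h2).mul_const z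
  refine (h3.const_mul x).congr fun u => ?_
  have h4 := h (m.fst (star u))
  simp only [Function.comp_apply, star_mul, star_star, DoubleCentralizer.star_snd, map_star]
  rw [mul_assoc, ← h4, fst_mul, map_mul, mul_assoc]

/-- The multiplier `f̄(m)` of `B`. -/
noncomputable def extMult (m : 𝓜(ℂ, A)) : 𝓜(ℂ, B) where
  fst := LinearMap.mkContinuous
    { toFun := extAct H m
      map_add' := fun x y => tendsto_nhds_unique (extAct_tendsto H m (x + y))
        (((extAct_tendsto H m x).add (extAct_tendsto H m y)).congr fun u => (mul_add _ _ _).symm)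
      map_smul' := fun c x => tendsto_nhds_unique (extAct_tendsto H m (c • x))
        (((extAct_tendsto H m x).const_smul c).congr fun u => (mul_smul_comm _ _ _).symm) }
    ‖m‖ (extAct_norm_le H m)
  snd := LinearMap.mkContinuous
    { toFun := fun x => star (extAct H (star m) (star x))
      map_add' := fun x y => eq_of_forall_eq_mul fun z => by
        rw [add_mul]; simp only [extAct_central, add_mul]
      map_smul' := fun c x => eq_of_forall_eq_mul fun z => by
        simp only [extAct_central, smul_mul_assoc, RingHom.id_apply] }
    ‖m‖ (fun x => by
      have := extAct_norm_le H (star m) (star x)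
      rwa [norm_star, norm_star, ← norm_star (extAct H _ _)] at this)
  central := extAct_central H m

theorem multiplier_ext {m n : 𝓜(ℂ, B)} (h : ∀ b, m.fst b = n.fst b) : m = n :=
  DoubleCentralizer.ext ℂ B _ _ <| Prod.ext (ContinuousLinearMap.ext h) <|
    ContinuousLinearMap.ext fun x => eq_of_forall_eq_mul fun y => by
      rw [m.central, n.central, h]

/-- A homomorphism `f : A → B` such that every element of `B` is of the form `f(a) z` modulo
the annihilator of `f(A)` is extendible. -/
theorem extendible_of_hasFactor (H : ∀ b, ∃ (a : A) (z : B), HasFactor f b a z) :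
    Extendible f := by
  have hfst : ∀ m b, (extMult H m).fst b = extAct H m b := fun m b => rfl
  have hsnd : ∀ m b, (extMult H m).snd b = star (extAct H (star m) (star b)) := fun m b => rfl
  have hadd : ∀ m n b, extAct H (m + n) b = extAct H m b + extAct H n b := fun m n b => by
    obtain ⟨a, z, h⟩ := H b
    rw [extAct_eq H h, extAct_eq H h, extAct_eq H h, DoubleCentralizer.add_fst,
      add_apply, map_add, add_mul]
  have hsmul : ∀ (c : ℂ) m b, extAct H (c • m) b = c • extAct H m b := fun c m b => by
    obtain ⟨a, z, h⟩ := H b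
    rw [extAct_eq H h, extAct_eq H h, DoubleCentralizer.smul_fst,
      smul_apply, map_smul, smul_mul_assoc]
  refine ⟨{ toFun := extMult H
            map_smul' := fun c m => multiplier_ext fun b => hsmul c m b
            map_zero' := multiplier_ext fun b => ?_
            map_add' := fun m n => multiplier_ext fun b => hadd m n b
            map_mul' := fun m n => multiplier_ext fun b => extAct_mul H m n b
            map_star' := fun m => multiplier_ext fun b => ?_ }, ?_, ?_⟩
  · have := hsmul 0 0 b
    rwa [zero_smul, zero_smul] at this
  · rw [DoubleCentralizer.star_fst, hsnd, hfst, star_star, star_star]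
  · have cont : ∀ b, @Continuous _ _ (strictTopology A) _ fun m => extAct H m b := fun b => by
      obtain ⟨a, z, h⟩ := H b
      simp only [extAct_eq H h]
      let := strictTopology A
      have : Continuous fun m : 𝓜(ℂ, A) => m.fst a :=
        (continuous_apply a).comp (continuous_fst.comp (continuous_strict_pair A))
      exact ((continuous_hom f).comp this).mul continuous_const
    have cstar : @Continuous _ _ (strictTopology A) (strictTopology A)
        (star : 𝓜(ℂ, A) → 𝓜(ℂ, A)) := by
      let := strictTopology A
      have c0 := continuous_strict_pair A
      refine continuous_induced_rng.mpr (Continuous.prodMk ?_ ?_)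
      · refine continuous_pi fun a => ?_
        simp only [DoubleCentralizer.star_fst]
        exact ((continuous_apply (star a)).comp (continuous_snd.comp c0)).star
      · refine continuous_pi fun a => ?_
        simp only [DoubleCentralizer.star_snd]
        exact ((continuous_apply (star a)).comp (continuous_fst.comp c0)).star
    let := strictTopology A
    refine continuous_induced_rng.mpr (Continuous.prodMk ?_ ?_)
    · exact continuous_pi fun b => cont b
    · exact continuous_pi fun b => ((cont (star b)).comp cstar).star
  · refine fun a => multiplier_ext fun b => ?_
    obtain ⟨a', z, h⟩ := H b
    change extAct H _ b = f a * b
    rw [extAct_eq H h, ← h a, ← mul_assoc, ← map_mul]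
    rfl

end Extension

/-- Strong convergence along a bounded net may be tested on a dense set of vectors. -/
theorem isClosed_setOf_convergent {ι : Type*} {l : Filter ι} [l.NeBot] {e : ι → B}
    (he : ∀ᶠ i in l, ‖e i‖ ≤ 1) : IsClosed {b : B | ∃ y, Tendsto (fun i => e i * b) l (𝓝 y)} := by
  refine isClosed_of_closure_subset fun b hb => ?_
  rw [Metric.mem_closure_iff] at hb
  suffices Cauchy (map (fun i => e i * b) l) from CompleteSpace.complete this
  rw [Metric.cauchy_iff]
  refine ⟨inferInstance, fun ε hε => ?_⟩
  obtain ⟨x, ⟨y, hy⟩, hxb⟩ := hb (ε / 4) (by positivity)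
  refine ⟨Metric.ball y (ε / 2), mem_map.mpr ?_, fun s hs t ht => ?_⟩
  · filter_upwards [Metric.tendsto_nhds.mp hy (ε / 4) (by positivity), he] with i h1 h2
    have h4 : dist (e i * b) (e i * x) ≤ dist b x := by
      rw [dist_eq_norm, dist_eq_norm, ← mul_sub]
      exact (norm_mul_le _ _).trans (mul_le_of_le_one_left (norm_nonneg _) h2)
    exact (dist_triangle (e i * b) (e i * x) y).trans_lt (by linarith)
  · have h1 := Metric.mem_ball.mp hs
    have h2 := Metric.mem_ball'.mp ht
    exact (dist_triangle s y t).trans_lt (by linarith)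

end Strict

/-! ### The annihilator of the kernel and complete transfer operators -/

section Transfer

variable {A B : Type*} [NonUnitalCStarAlgebra A] [NonUnitalCStarAlgebra B]

/-- The annihilator `(ker β)^⊥`, as a closed ideal. -/
def kerPerpIdeal (β : B →⋆ₙₐ[ℂ] B) : ClosedIdeal B where
  carrier := kerPerp β
  add_mem' ha hb := fun c hc => by rw [add_mul, ha c hc, hb c hc, add_zero]
  zero_mem' := fun c _ => zero_mul c
  smul_mem' z a ha := fun c hc => by rw [smul_mul_assoc, ha c hc, smul_zero]
  isClosed' := by
    have e : kerPerp β = ⋂ (c : B) (_ : β c = 0), {a | a * c = 0} := by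
      ext a; simp [kerPerp]
    change IsClosed (kerPerp β)
    rw [e]
    exact isClosed_iInter fun c => isClosed_iInter fun _ =>
      isClosed_eq (continuous_mul_const c) continuous_const
  mul_mem_left' a x hx := fun c hc => by rw [mul_assoc, hx c hc, mul_zero]
  mul_mem_right' a x hx := fun c hc => by
    rw [mul_assoc]; exact hx _ (by rw [map_mul, hc, mul_zero])

theorem mem_kerPerpIdeal {β : B →⋆ₙₐ[ℂ] B} {a : B} :
    a ∈ (kerPerpIdeal β).toSubmodule ↔ a ∈ kerPerp β := Iff.rfl

theorem mul_kerPerp {β : B →⋆ₙₐ[ℂ] B} {a c : B} (ha : a ∈ kerPerp β) (hc : β c = 0) :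
    c * a = 0 := by
  have h := (kerPerpIdeal β).star_mem ha (star c) (by rw [map_star, hc, star_zero])
  rw [← star_mul] at h
  exact star_eq_zero.mp h

theorem mem_kerPerp_of_left {β : B →⋆ₙₐ[ℂ] B} {a : B} (h : ∀ c, β c = 0 → c * a = 0) :
    a ∈ kerPerp β := by
  have h1 : star a ∈ (kerPerpIdeal β).toSubmodule := fun c hc => by
    have := h (star c) (by rw [map_star, hc, star_zero])
    rw [← star_star c, ← star_mul, this, star_zero]
  simpa using mem_kerPerpIdeal.mp ((kerPerpIdeal β).star_mem h1)

theorem kerPerp_eq_zero {β : B →⋆ₙₐ[ℂ] B} {d : B} (hd : d ∈ kerPerp β) (h : β d = 0) : d = 0 :=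
  (CStarRing.star_mul_self_eq_zero_iff d).mp <|
    mul_kerPerp hd (by rw [map_star, h, star_zero])

theorem kerPerp_ext {β : B →⋆ₙₐ[ℂ] B} {d d' : B} (hd : d ∈ kerPerp β) (hd' : d' ∈ kerPerp β)
    (h : β d = β d') : d = d' :=
  sub_eq_zero.mp <| kerPerp_eq_zero (β := β)
    (mem_kerPerpIdeal.mp (sub_mem (mem_kerPerpIdeal.mpr hd) (mem_kerPerpIdeal.mpr hd')))
    (by rw [map_sub, h, sub_self])

/-- The map `b ↦ (β b, [b])` into `B × B/(ker β)^⊥` is injective, hence isometric, and its second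
component vanishes on `(ker β)^⊥`. -/
theorem norm_map_of_mem_kerPerp {β : B →⋆ₙₐ[ℂ] B} {d : B} (hd : d ∈ kerPerp β) : ‖β d‖ = ‖d‖ := by
  have hinj : Function.Injective (β.prod (kerPerpIdeal β).q) := by
    refine (injective_iff_map_eq_zero _).mpr fun x hx => ?_
    have h1 : β x = 0 := congrArg Prod.fst hx
    have h2 : (kerPerpIdeal β).q x = (kerPerpIdeal β).q 0 := by
      rw [map_zero]; exact congrArg Prod.snd hx
    rw [ClosedIdeal.q_eq, sub_zero] at h2
    exact kerPerp_eq_zero h2 h1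
  have h := NonUnitalStarAlgHom.norm_map _ hinj d
  have h2 : (kerPerpIdeal β).q d = 0 := by
    rw [← map_zero (kerPerpIdeal β).q, ClosedIdeal.q_eq, sub_zero]; exact hd
  have e : (β.prod (kerPerpIdeal β).q) d = (β d, 0) := Prod.ext rfl h2
  rw [e, Prod.norm_def] at h
  simpa using h

/-- The compression `b ↦ β̄(1) b β̄(1)`. -/
noncomputable def compress {β : B →⋆ₙₐ[ℂ] B} (hβ : Extendible β) (b : B) : B :=
  (hβ.ext 1).fst ((hβ.ext 1).snd b)

section

variable {β : B →⋆ₙₐ[ℂ] B} (hβ : Extendible β)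

theorem ext_one_fst_map (b : B) : (hβ.ext 1).fst (β b) = β b := (hβ.map_fst 1 b).symm

theorem ext_one_snd_map (b : B) : (hβ.ext 1).snd (β b) = β b := (hβ.map_snd 1 b).symm

theorem isStarProjection_ext_one : IsStarProjection (hβ.ext 1) :=
  (IsStarProjection.one _).map hβ.ext

theorem projection_fst_fst {p : 𝓜(ℂ, B)} (hp : IsStarProjection p) (b : B) :
    p.fst (p.fst b) = p.fst b :=
  congrArg (fun m : 𝓜(ℂ, B) => m.fst b) hp.isIdempotentElem

theorem projection_snd_snd {p : 𝓜(ℂ, B)} (hp : IsStarProjection p) (b : B) :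
    p.snd (p.snd b) = p.snd b :=
  congrArg (fun m : 𝓜(ℂ, B) => m.snd b) hp.isIdempotentElem

theorem projection_star_snd {p : 𝓜(ℂ, B)} (hp : IsStarProjection p) (b : B) :
    star (p.snd b) = p.fst (star b) := by
  have := congrArg (fun m : 𝓜(ℂ, B) => m.fst (star b)) hp.isSelfAdjoint.star_eq
  simpa using this

theorem projection_star_fst {p : 𝓜(ℂ, B)} (hp : IsStarProjection p) (b : B) :
    star (p.fst b) = p.snd (star b) := by
  rw [← star_star (p.snd (star b)), projection_star_snd hp, star_star]

theorem fst_snd_comm (m n : 𝓜(ℂ, B)) (b : B) : m.fst (n.snd b) = n.snd (m.fst b) :=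
  coe_injective <| by simp only [coe_fst_apply, coe_snd_apply, mul_assoc]

theorem compress_map (b : B) : compress hβ (β b) = β b := by
  rw [compress, ext_one_snd_map, ext_one_fst_map]

theorem compress_map_mul (a b : B) : compress hβ (β a * b) = β a * compress hβ b := by
  rw [compress, compress, snd_mul, fst_mul, ext_one_fst_map, ← (hβ.ext 1).central,
    ext_one_snd_map]

theorem compress_mul_map (b a : B) : compress hβ (b * β a) = compress hβ b * β a := by
  rw [compress, compress, snd_mul, ext_one_snd_map, fst_mul, fst_snd_comm, (hβ.ext 1).central,
    ext_one_fst_map]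

/-- A compressed positive element has a square root in the corner. -/
theorem exists_sqrt_compress (b : B) :
    ∃ r : B, compress hβ (star b * b) = star r * r ∧ compress hβ r = r := by
  let := CStarAlgebra.spectralOrder B
  have := CStarAlgebra.spectralOrderedRing B
  set p := hβ.ext 1 with hp_def
  have hp : IsStarProjection p := isStarProjection_ext_one hβ
  have e1 : compress hβ (star b * b) = star (p.snd b) * p.snd b := by
    rw [compress, snd_mul, fst_mul, ← hp_def, projection_star_snd hp]
  set x := star (p.snd b) * p.snd b with hx
  have hx0 : 0 ≤ x := star_mul_self_nonneg _
  have hr : CFC.sqrt x * CFC.sqrt x = x := CFC.sqrt_mul_sqrt_self x hx0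
  have hrs : star (CFC.sqrt x) = CFC.sqrt x := (IsSelfAdjoint.of_nonneg (CFC.sqrt_nonneg x)).star_eq
  set r := CFC.sqrt x
  have hpx : p.fst x = x := by rw [hx, projection_star_snd hp, ← fst_mul, projection_fst_fst hp]
  have hxp : p.snd x = x := by rw [hx, snd_mul, projection_snd_snd hp]
  have hpr : p.fst r = r := by
    refine (sub_eq_zero.mp ((CStarRing.mul_star_self_eq_zero_iff _).mp ?_)).symm
    rw [star_sub, projection_star_fst hp, hrs, sub_mul, mul_sub, mul_sub, ← snd_mul, ← fst_mul,
      ← snd_mul, ← fst_mul, hr, hxp, hpx, hxp, sub_self]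
  have hrp : p.snd r = r := by
    have := congrArg star hpr
    rwa [projection_star_fst hp, hrs] at this
  exact ⟨r, by rw [e1, hrs, hr], by rw [compress, ← hp_def, hrp, hpr]⟩

theorem isClosed_image_kerPerp (β : B →⋆ₙₐ[ℂ] B) : IsClosed (β '' kerPerp β) := by
  have : CompleteSpace (kerPerpIdeal β).toSubmodule := (kerPerpIdeal β).isClosed'.completeSpace_coe
  have h : Isometry fun d : (kerPerpIdeal β).toSubmodule => β d.1 :=
    Isometry.of_dist_eq fun d d' => by
      rw [dist_eq_norm, ← map_sub, norm_map_of_mem_kerPerp (sub_mem d.2 d'.2), ← dist_eq_norm]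
      rfl
  have h2 := h.isClosedEmbedding.isClosed_range
  convert h2 using 1
  ext x
  exact ⟨fun ⟨d, hd, e⟩ => ⟨⟨d, hd⟩, e⟩, fun ⟨d, e⟩ => ⟨d.1, d.2, e⟩⟩

theorem isClosed_setOf_compress_mem :
    IsClosed {b | ∃ d ∈ kerPerp β, β d = compress hβ b} :=
  (isClosed_image_kerPerp β).preimage
    ((hβ.ext 1).fst.continuous.comp (hβ.ext 1).snd.continuous)

/-- The complete transfer operator is the inverse of `β : (ker β)^⊥ → β̄(1) B β̄(1)`, preceded by
the compression: if `β` maps `(ker β)^⊥` onto the corner, it exists. -/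
theorem exists_completeTransferOperator (H : ∀ b, ∃ d ∈ kerPerp β, β d = compress hβ b) :
    ∃ L : B →ₗ[ℂ] B, IsCompleteTransferOperator β hβ L := by
  choose L hL1 hL2 using H
  have hadd : ∀ x y, L (x + y) = L x + L y := fun x y =>
    kerPerp_ext (hL1 _) ((kerPerpIdeal β).toSubmodule.add_mem (hL1 x) (hL1 y)) <| by
      simp only [map_add, hL2, compress]
  have hsmul : ∀ (c : ℂ) x, L (c • x) = c • L x := fun c x =>
    kerPerp_ext (hL1 _) ((kerPerpIdeal β).toSubmodule.smul_mem c (hL1 x)) <| by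
      simp only [map_smul, hL2, compress]
  have hpos : ∀ a, ∃ b, L (star a * a) = star b * b := fun a => by
    obtain ⟨r, h1, h2⟩ := exists_sqrt_compress hβ a
    refine ⟨L r, kerPerp_ext (hL1 _) ((kerPerpIdeal β).mul_left _ (hL1 r)) ?_⟩
    rw [map_mul, map_star, hL2, hL2, h2, h1]
  have htransfer : ∀ a b, L (β a * b) = a * L b := fun a b => by
    refine kerPerp_ext (hL1 _) ((kerPerpIdeal β).mul_left _ (hL1 b)) ?_
    rw [map_mul, hL2, hL2, compress_map_mul]
  exact ⟨⟨⟨L, hadd⟩, hsmul⟩, hpos, htransfer, hL2⟩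

end

namespace IsCompleteTransferOperator

variable {β : B →⋆ₙₐ[ℂ] B} {hβ : Extendible β} {L : B →ₗ[ℂ] B}

theorem mem_kerPerp (hL : IsCompleteTransferOperator β hβ L) (b : B) : L b ∈ kerPerp β :=
  mem_kerPerp_of_left fun c hc => by rw [← hL.transfer, hc, zero_mul, map_zero]

theorem map_apply (hL : IsCompleteTransferOperator β hβ L) (b : B) :
    β (L b) = compress hβ b := hL.complete b

theorem eq_of_mem (hL : IsCompleteTransferOperator β hβ L) {b d : B}
    (hd : d ∈ kerPerp β) (h : β d = compress hβ b) : L b = d :=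
  kerPerp_ext (hL.mem_kerPerp b) hd (by rw [hL.map_apply, h])

theorem apply_map_eq_iff (hL : IsCompleteTransferOperator β hβ L) (c : B) :
    L (β c) = c ↔ c ∈ kerPerp β :=
  ⟨fun h => h ▸ hL.mem_kerPerp _, fun h => hL.eq_of_mem h (compress_map hβ c).symm⟩

theorem transfer_right (hL : IsCompleteTransferOperator β hβ L) (b c : B) :
    L (b * β c) = L b * c := by
  refine hL.eq_of_mem ((kerPerpIdeal β).mul_right _ (hL.mem_kerPerp b)) ?_
  rw [map_mul, hL.map_apply, compress_mul_map]

theorem continuous (hL : IsCompleteTransferOperator β hβ L) : Continuous L := by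
  refine AddMonoidHomClass.continuous_of_bound L (‖(hβ.ext 1).fst‖ * ‖(hβ.ext 1).snd‖) fun b => ?_
  rw [← norm_map_of_mem_kerPerp (hL.mem_kerPerp b), hL.map_apply, mul_assoc]
  exact ((hβ.ext 1).fst.le_opNorm _).trans (by gcongr; exact (hβ.ext 1).snd.le_opNorm _)

/-- The extension sends a multiplier `m` to the multiplier with left action `a ↦ L(m β(a))` and
right action `a ↦ L(β(a) m)`. -/
theorem exists_strictExtension (hL : IsCompleteTransferOperator β hβ L) :
    ∃ Lbar : 𝓜(ℂ, B) → 𝓜(ℂ, B), IsStrictExtension L Lbar := by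
  have c1 : Continuous fun b => β b := continuous_hom β
  let T : B →L[ℂ] B := ⟨L, hL.continuous⟩
  let b : B →L[ℂ] B := ⟨(β : B →ₗ[ℂ] B), c1⟩
  refine ⟨fun m => ⟨(T ∘L m.fst ∘L b, T ∘L m.snd ∘L b), fun x y => ?_⟩, ?_, fun a => ?_⟩
  · change L (m.snd (β x)) * y = x * L (m.fst (β y))
    rw [← hL.transfer, ← hL.transfer_right, m.central]
  · let := strictTopology B
    have c0 := continuous_strict_pair B
    refine continuous_induced_rng.mpr (Continuous.prodMk ?_ ?_)
    · exact continuous_pi fun a => hL.continuous.comp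
        ((continuous_apply (β a)).comp (continuous_fst.comp c0))
    · exact continuous_pi fun a => hL.continuous.comp
        ((continuous_apply (β a)).comp (continuous_snd.comp c0))
  · exact multiplier_ext fun x => hL.transfer_right a x

theorem strictExtension_one_apply (hL : IsCompleteTransferOperator β hβ L)
    {Lbar : 𝓜(ℂ, B) → 𝓜(ℂ, B)} (h : IsStrictExtension L Lbar) (c : B) :
    (Lbar 1).fst c = L (β c) := by
  have h1 := (h.strictTendsto strictTendsto_approxUnit).left c
  have h2 := (hL.continuous.tendsto _).comp (approxUnit_mul (β c))
  exact tendsto_nhds_unique h1 (h2.congr fun u => hL.transfer_right u c)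

end IsCompleteTransferOperator

/-! ### Morphisms and transfer operators -/

theorem strictTendsto_of_nondegenerate {T : A →⋆ₙₐ[ℂ] B}
    (h : (Submodule.span ℂ {x : B | ∃ a b, x = T a * b}).topologicalClosure = ⊤) :
    StrictTendsto (fun u => T u) (approxUnit A) 1 := by
  have left : ∀ b, Tendsto (fun u => T u * b) (approxUnit A) (𝓝 b) := fun b => by
    let N : Submodule ℂ B :=
      { carrier := {y | Tendsto (fun u => T u * y) (approxUnit A) (𝓝 y)}
        add_mem' := fun hx hy => (hx.add hy).congr fun u => (mul_add _ _ _).symm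
        zero_mem' := by simp
        smul_mem' := fun c x hx => (hx.const_smul c).congr fun u => (mul_smul_comm _ _ _).symm }
    have hN : (Submodule.span ℂ {x : B | ∃ a b, x = T a * b}).topologicalClosure ≤ N := by
      refine Submodule.topologicalClosure_minimal _ (Submodule.span_le.mpr ?_)
        (isClosed_setOf_fixed T)
      rintro _ ⟨a, y, rfl⟩
      have := (((continuous_hom T).tendsto _).comp (approxUnit_mul a)).mul_const y
      exact this.congr fun u => by simp [mul_assoc]
    rw [h] at hN
    exact hN (Submodule.mem_top (x := b))
  refine ⟨left, fun b => ?_⟩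
  have h1 := (left (star b)).star
  rw [star_star] at h1
  refine h1.congr' (approxUnit_star.mono fun u hu => ?_)
  rw [star_mul, star_star, ← map_star, hu]

theorem nondegenerate_of_tendsto {T : A →⋆ₙₐ[ℂ] B} {ι : Type*} {l : Filter ι} [l.NeBot] {e : ι → A}
    (h : ∀ b, Tendsto (fun i => T (e i) * b) l (𝓝 b)) :
    (Submodule.span ℂ {x : B | ∃ a b, x = T a * b}).topologicalClosure = ⊤ := by
  refine eq_top_iff.mpr fun b _ => ?_
  exact (Submodule.isClosed_topologicalClosure _).mem_of_tendsto (h b) (Eventually.of_forall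
    fun i => Submodule.le_topologicalClosure _ (Submodule.subset_span ⟨_, _, rfl⟩))

variable {α : A →⋆ₙₐ[ℂ] A} {β : B →⋆ₙₐ[ℂ] B} {T : A →⋆ₙₐ[ℂ] B}

theorem iterate_commutes (h : ∀ a, T (α a) = β (T a)) (n : ℕ) (a : A) :
    T (α^[n] a) = β^[n] (T a) :=
  Function.Semiconj.iterate_right (f := T) h n a

/-- A morphism satisfies `T(ᾱⁿ(1) a) = β̄ⁿ(1) T(a)` and `T(a ᾱⁿ(1)) = T(a) β̄ⁿ(1)`. -/
theorem IsMorphism.map_unitImage (hT : IsMorphism α β T) (hα : Extendible α) (hβ : Extendible β)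
    (n : ℕ) (a : A) : T ((unitImage α hα n).fst a) = (unitImage β hβ n).fst (T a) ∧
      T ((unitImage α hα n).snd a) = (unitImage β hβ n).snd (T a) := by
  have h1 := strictTendsto_approxUnit.iterate hα n
  have h2 := (strictTendsto_of_nondegenerate hT.nondegenerate).iterate hβ n
  constructor
  · refine tendsto_nhds_unique (((continuous_hom T).tendsto _).comp (h1.left a)) ?_
    exact (h2.left (T a)).congr fun u => by
      simp [iterate_commutes hT.commutes]
  · refine tendsto_nhds_unique (((continuous_hom T).tendsto _).comp (h1.right a)) ?_
    exact (h2.right (T a)).congr fun u => by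
      simp [iterate_commutes hT.commutes]

theorem IsMorphism.map_mem_cornerSeq (hT : IsMorphism α β T) (hα : Extendible α)
    (hβ : Extendible β) {n : ℕ} {a : A} (ha : a ∈ cornerSeq α hα n) :
    T a ∈ cornerSeq β hβ n := by
  obtain ⟨h1, h2⟩ := hT.map_unitImage hα hβ n a
  exact ⟨by rw [← h1, ha.1], by rw [← h2, ha.2]⟩

/-- Covariant embeddings of reversible systems intertwine the complete transfer operators. -/
theorem IsCovariantEmbedding.map_transfer (hT : IsCovariantEmbedding α β T) {hα : Extendible α}
    {hβ : Extendible β} {L : A →ₗ[ℂ] A} {M : B →ₗ[ℂ] B}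
    (hL : IsCompleteTransferOperator α hα L) (hM : IsCompleteTransferOperator β hβ M) (a : A) :
    T (L a) = M (T a) := by
  refine (hM.eq_of_mem ?_ ?_).symm
  · have : L a ∈ T ⁻¹' kerPerp β := hT.preimage_eq ▸ hL.mem_kerPerp a
    exact this
  · rw [← hT.commutes, hL.map_apply, compress, compress]
    have h1 := hT.map_unitImage hα hβ 1
    have e : ∀ b, T ((hα.ext 1).fst b) = (hβ.ext 1).fst (T b) := fun b => (h1 b).1
    have e' : ∀ b, T ((hα.ext 1).snd b) = (hβ.ext 1).snd (T b) := fun b => (h1 b).2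
    rw [e, e']

end Transfer

/-! ### Direct limits -/

section DirectLimit

variable {X : ℕ → Type*} [∀ n, NonUnitalCStarAlgebra (X n)] (t : ∀ n, X n →⋆ₙₐ[ℂ] X (n + 1))

/-- The homomorphism `x ↦ (0, …, 0, x, t_n x, t_{n+1} t_n x, …)` with `x` in position `n`. -/
noncomputable def threadFrom (n : ℕ) : ∀ m, X n →⋆ₙₐ[ℂ] X m
  | 0 => if h : n = 0 then h ▸ NonUnitalStarAlgHom.id ℂ (X n) else 0
  | m + 1 => if h : n = m + 1 then h ▸ NonUnitalStarAlgHom.id ℂ (X n) else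
      (t m).comp (threadFrom n m)

theorem threadFrom_self (n : ℕ) (x : X n) : threadFrom t n n x = x := by
  cases n <;> simp [threadFrom]

theorem threadFrom_succ {n m : ℕ} (h : n ≤ m) (x : X n) :
    threadFrom t n (m + 1) x = t m (threadFrom t n m x) := by
  have : ¬ n = m + 1 := by omega
  rw [threadFrom, dif_neg this]; rfl

theorem threadFrom_zero (m : ℕ) : threadFrom t 0 m = thread t m := by
  induction m with
  | zero => exact NonUnitalStarAlgHom.ext fun x => threadFrom_self t 0 x
  | succ m ih =>
    refine NonUnitalStarAlgHom.ext fun x => ?_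
    rw [threadFrom_succ t (Nat.zero_le m), ih]; rfl

theorem threadFrom_bond {n m : ℕ} (h : n + 1 ≤ m) (x : X n) :
    threadFrom t (n + 1) m (t n x) = threadFrom t n m x := by
  induction m, h using Nat.le_induction with
  | base => rw [threadFrom_self, threadFrom_succ t le_rfl, threadFrom_self]
  | succ m hm ih => rw [threadFrom_succ t hm, threadFrom_succ t (by omega), ih]

theorem norm_threadFrom (ht : ∀ n, Function.Injective (t n)) {n m : ℕ} (h : n ≤ m) (x : X n) :
    ‖threadFrom t n m x‖ = ‖x‖ := by
  induction m, h using Nat.le_induction with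
  | base => rw [threadFrom_self]
  | succ m hm ih => rw [threadFrom_succ t hm, NonUnitalStarAlgHom.norm_map _ (ht m), ih]

/-- The sequence `(0, …, 0, x, t_n x, t_{n+1} t_n x, …)` in the `ℓ^∞`-product. -/
noncomputable def threadSeq (n : ℕ) (x : X n) : lp X ∞ :=
  toLp (fun m => threadFrom t n m x) ‖x‖ fun m => norm_map_le (threadFrom t n m) x

theorem threadSeq_mem (n : ℕ) (x : X n) : threadSeq t n x ∈ threadAlg t :=
  ⟨n, fun _ hm => threadFrom_succ t hm x⟩

/-- The natural homomorphism of `X n` to the direct limit. -/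
noncomputable def dirLimOf (n : ℕ) : X n →⋆ₙₐ[ℂ] DirLim t where
  toFun x := ⟨(nullIdeal X).q (threadSeq t n x), q_mem_dirLimAlg (threadSeq_mem t n x)⟩
  map_smul' c x := Subtype.ext <| congrArg (nullIdeal X).q <|
    Subtype.ext (funext fun m => map_smul (threadFrom t n m) c x)
  map_zero' := Subtype.ext <| congrArg (nullIdeal X).q <|
    Subtype.ext (funext fun m => map_zero (threadFrom t n m))
  map_add' x y := Subtype.ext <| congrArg (nullIdeal X).q <|
    Subtype.ext (funext fun m => map_add (threadFrom t n m) x y)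
  map_mul' x y := Subtype.ext <| congrArg (nullIdeal X).q <|
    Subtype.ext (funext fun m => map_mul (threadFrom t n m) x y)
  map_star' x := Subtype.ext <| congrArg (nullIdeal X).q <|
    Subtype.ext (funext fun m => map_star (threadFrom t n m) x)

theorem dirLimOf_zero (x : X 0) : dirLimOf t 0 x = dirLimZero t x :=
  Subtype.ext <| congrArg (nullIdeal X).q <| Subtype.ext <| funext fun m => by
    change threadFrom t 0 m x = thread t m x
    rw [threadFrom_zero]

theorem mem_nullIdeal {x : lp X ∞} :
    x ∈ (nullIdeal X).toSubmodule ↔ Tendsto (fun n => ‖x n‖) atTop (𝓝 0) := Iff.rfl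

theorem q_eq_of_eventuallyEq {x y : lp X ∞} (h : ∀ᶠ n in atTop, x n = y n) :
    (nullIdeal X).q x = (nullIdeal X).q y := by
  rw [ClosedIdeal.q_eq, mem_nullIdeal]
  refine tendsto_const_nhds.congr' (h.mono fun n hn => ?_)
  change 0 = ‖x n - y n‖
  rw [hn, sub_self, norm_zero]

theorem dirLimOf_bond (n : ℕ) (x : X n) : dirLimOf t (n + 1) (t n x) = dirLimOf t n x :=
  Subtype.ext <| q_eq_of_eventuallyEq <| (eventually_ge_atTop (n + 1)).mono fun _ hm =>
    threadFrom_bond t hm x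

theorem dirLimMap_dirLimOf (b : ∀ n, X n →⋆ₙₐ[ℂ] X n) (h : ∀ n x, t n (b n x) = b (n + 1) (t n x))
    (n : ℕ) (x : X n) : dirLimMap t b h (dirLimOf t n x) = dirLimOf t n (b n x) := by
  refine Subtype.ext <| q_eq_of_eventuallyEq <| (eventually_ge_atTop n).mono fun m hm => ?_
  change b m (threadFrom t n m x) = threadFrom t n m (b n x)
  induction m, hm using Nat.le_induction with
  | base => rw [threadFrom_self, threadFrom_self]
  | succ m hm ih => rw [threadFrom_succ t hm, threadFrom_succ t hm, ← h, ih]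

theorem exists_thread_near (b : DirLim t) {ε : ℝ} (hε : 0 < ε) :
    ∃ y ∈ threadAlg t, ‖b.1 - (nullIdeal X).q y‖ < ε := by
  obtain ⟨_, ⟨y, hy, rfl⟩, h⟩ := Metric.mem_closure_iff.mp b.2 ε hε
  exact ⟨y, hy, by rwa [dist_eq_norm] at h⟩

theorem exists_dirLimOf_near (b : DirLim t) {ε : ℝ} (hε : 0 < ε) :
    ∃ (n : ℕ) (x : X n), ‖b - dirLimOf t n x‖ < ε := by
  obtain ⟨y, ⟨N, hN⟩, h⟩ := exists_thread_near t b hε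
  refine ⟨N, y N, ?_⟩
  have e : (nullIdeal X).q y = (nullIdeal X).q (threadSeq t N (y N)) :=
    q_eq_of_eventuallyEq <| (eventually_ge_atTop N).mono fun m hm => by
      change y m = threadFrom t N m (y N)
      induction m, hm using Nat.le_induction with
      | base => rw [threadFrom_self]
      | succ m hm ih => rw [threadFrom_succ t hm, hN m hm, ih]
  rw [e] at h
  exact h

/-- The algebras `X n` have dense union in the direct limit. -/
theorem dirLim_induction {P : DirLim t → Prop} (hP : IsClosed {b | P b})
    (h : ∀ n x, P (dirLimOf t n x)) (b : DirLim t) : P b := by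
  have : b ∈ closure {b | P b} := Metric.mem_closure_iff.mpr fun ε hε => by
    obtain ⟨n, x, hx⟩ := exists_dirLimOf_near t b hε
    exact ⟨_, h n x, by rwa [dist_eq_norm]⟩
  rwa [hP.closure_eq] at this

theorem exists_q_eq_norm_lt (x : (nullIdeal X).Quot) {ε : ℝ} (hε : ‖x‖ < ε) :
    ∃ a : lp X ∞, (nullIdeal X).q a = x ∧ ‖a‖ < ε := by
  obtain ⟨a, h1, h2⟩ := (nullIdeal X).exists_cls x (sub_pos.mpr hε)
  refine ⟨a, h1, h2.trans_le ?_⟩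
  exact (add_sub_cancel _ _).le

theorem norm_dirLimOf (ht : ∀ n, Function.Injective (t n)) (n : ℕ) (x : X n) :
    ‖dirLimOf t n x‖ = ‖x‖ := by
  refine le_antisymm (norm_map_le _ x) (le_of_forall_gt fun ε hε => ?_)
  obtain ⟨y, h1, h2⟩ := exists_q_eq_norm_lt ((nullIdeal X).q (threadSeq t n x)) hε
  rw [ClosedIdeal.q_eq, mem_nullIdeal] at h1
  have h3 : ∀ᶠ m in atTop, ‖x‖ ≤ ‖y‖ + ‖(y - threadSeq t n x) m‖ :=
    (eventually_ge_atTop n).mono fun m hm => by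
      rw [← norm_threadFrom t ht hm x]
      have h4 : ‖y m‖ ≤ ‖y‖ := lp.norm_apply_le_norm ENNReal.top_ne_zero y m
      have h5 : threadFrom t n m x = y m - (y - threadSeq t n x) m := by
        change _ = y m - (y m - threadFrom t n m x)
        rw [sub_sub_cancel]
      rw [h5]
      exact (norm_sub_le _ _).trans (by gcongr)
  have h6 := ge_of_tendsto (h1.const_add ‖y‖) h3
  rw [add_zero] at h6
  exact h6.trans_lt h2

section Lift

variable {C : Type*} [NonUnitalCStarAlgebra C] (f : ∀ n, X n →⋆ₙₐ[ℂ] C)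
  (hf : ∀ n x, f (n + 1) (t n x) = f n x)

theorem tendsto_of_q_eq {x y : lp X ∞} (h : (nullIdeal X).q x = (nullIdeal X).q y) {c : C}
    (hx : Tendsto (fun n => f n (x n)) atTop (𝓝 c)) : Tendsto (fun n => f n (y n)) atTop (𝓝 c) := by
  rw [ClosedIdeal.q_eq, mem_nullIdeal] at h
  have h1 : Tendsto (fun n => f n (x n) - f n (y n)) atTop (𝓝 0) :=
    squeeze_zero_norm (fun n => by rw [← map_sub]; exact norm_map_le (f n) _) h
  have := hx.sub h1
  simpa using this

/-- The value of the homomorphism induced by the `f n` at a class `[(x n)]` is `lim f n (x n)`. -/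
theorem exists_lift_value (hf : ∀ n x, f (n + 1) (t n x) = f n x) (b : DirLim t) :
    ∃ c : C, ∀ x : lp X ∞, (nullIdeal X).q x = b.1 →
      Tendsto (fun n => f n (x n)) atTop (𝓝 c) := by
  obtain ⟨x, hx⟩ := (nullIdeal X).q_surjective b.1
  suffices CauchySeq fun n => f n (x n) by
    obtain ⟨c, hc⟩ := cauchySeq_tendsto_of_complete this
    exact ⟨c, fun y hy => tendsto_of_q_eq f (hx.trans hy.symm) hc⟩
  rw [Metric.cauchySeq_iff']
  intro ε hε
  obtain ⟨y, ⟨N, hN⟩, hy⟩ := exists_thread_near t b (ε := ε / 4) (by positivity)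
  obtain ⟨z, hz, hz'⟩ := exists_q_eq_norm_lt _ hy
  rw [← hx, ← map_sub, eq_comm, ClosedIdeal.q_eq, mem_nullIdeal] at hz
  obtain ⟨M, hM⟩ := Metric.tendsto_atTop.mp hz (ε / 4) (by positivity)
  have hconst : ∀ n, N ≤ n → f n (y n) = f N (y N) := fun n hn => by
    induction n, hn using Nat.le_induction with
    | base => rfl
    | succ m hm ih => rw [hN m hm, hf, ih]
  have key : ∀ n, max N M ≤ n → ‖f n (x n) - f N (y N)‖ < ε / 2 := fun n hn => by
    have h1 : f n (y n) = f N (y N) := hconst n (le_of_max_le_left hn)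
    have h2 : ‖x n - y n - z n‖ < ε / 4 := by
      have := hM n (le_of_max_le_right hn)
      rw [dist_zero_right, norm_norm] at this
      exact this
    have h3 : ‖z n‖ ≤ ‖z‖ := lp.norm_apply_le_norm ENNReal.top_ne_zero z n
    rw [← h1, ← map_sub]
    refine (norm_map_le (f n) _).trans_lt ?_
    have h4 := norm_add_le (x n - y n - z n) (z n)
    rw [sub_add_cancel] at h4
    linarith
  refine ⟨max N M, fun n hn => ?_⟩
  have h1 := key n hn
  have h2 := key _ le_rfl
  rw [← dist_eq_norm] at h1 h2
  exact (dist_triangle_right _ _ (f N (y N))).trans_lt (by linarith)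

/-- The homomorphism of the direct limit induced by a compatible sequence of homomorphisms. -/
noncomputable def dirLimLift : DirLim t →⋆ₙₐ[ℂ] C :=
  have spec := fun b => (exists_lift_value t f hf b).choose_spec
  have rep : ∀ b : DirLim t, ∃ x : lp X ∞, (nullIdeal X).q x = b.1 := fun b =>
    (nullIdeal X).q_surjective b.1
  { toFun := fun b => (exists_lift_value t f hf b).choose
    map_smul' := fun c b => by
      obtain ⟨x, hx⟩ := rep b
      refine tendsto_nhds_unique (spec (c • b) (c • x) (by rw [map_smul, hx]; rfl)) ?_
      exact ((spec b x hx).const_smul c).congr fun n => (map_smul (f n) c (x n)).symm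
    map_zero' := by
      refine tendsto_nhds_unique (spec 0 0 (by rw [map_zero]; rfl)) ?_
      exact tendsto_const_nhds.congr fun n => (map_zero (f n)).symm
    map_add' := fun b b' => by
      obtain ⟨x, hx⟩ := rep b
      obtain ⟨y, hy⟩ := rep b'
      refine tendsto_nhds_unique (spec (b + b') (x + y) (by rw [map_add, hx, hy]; rfl)) ?_
      exact ((spec b x hx).add (spec b' y hy)).congr fun n => (map_add (f n) (x n) (y n)).symm
    map_mul' := fun b b' => by
      obtain ⟨x, hx⟩ := rep b
      obtain ⟨y, hy⟩ := rep b'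
      refine tendsto_nhds_unique (spec (b * b') (x * y) (by rw [map_mul, hx, hy]; rfl)) ?_
      exact ((spec b x hx).mul (spec b' y hy)).congr fun n => (map_mul (f n) (x n) (y n)).symm
    map_star' := fun b => by
      obtain ⟨x, hx⟩ := rep b
      refine tendsto_nhds_unique (spec (star b) (star x) (by rw [map_star, hx]; rfl)) ?_
      exact ((spec b x hx).star).congr fun n => (map_star (f n) (x n)).symm }

theorem dirLimLift_of (n : ℕ) (x : X n) : dirLimLift t f hf (dirLimOf t n x) = f n x := by
  have h := (exists_lift_value t f hf (dirLimOf t n x)).choose_spec (threadSeq t n x) rfl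
  refine tendsto_nhds_unique h (tendsto_const_nhds.congr' ?_)
  refine (eventually_ge_atTop n).mono fun m hm => ?_
  change f n x = f m (threadFrom t n m x)
  induction m, hm using Nat.le_induction with
  | base => rw [threadFrom_self]
  | succ m hm ih => rw [threadFrom_succ t hm, hf, ih]

theorem dirLimLift_injective (hinj : ∀ n, Function.Injective (f n)) :
    Function.Injective (dirLimLift t f hf) := by
  refine (injective_iff_map_eq_zero _).mpr fun b hb => ?_
  have h : ‖b‖ ≤ ‖dirLimLift t f hf b‖ := by
    refine dirLim_induction t (P := fun b => ‖b‖ ≤ ‖dirLimLift t f hf b‖)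
      (isClosed_le continuous_norm (continuous_hom (dirLimLift t f hf)).norm) (fun n x => ?_) b
    rw [dirLimLift_of, NonUnitalStarAlgHom.norm_map _ (hinj n)]
    exact norm_map_le _ x
  rw [hb, norm_zero] at h
  exact norm_le_zero_iff.mp h

end Lift

end DirectLimit

/-! ### The algebra `B` and its generators -/

section NaturalExtension

variable {A : Type*} [NonUnitalCStarAlgebra A] (α : A →⋆ₙₐ[ℂ] A) (hα : Extendible α)
  (J : ClosedIdeal A)

instance isClosed_cornerSeq (n : ℕ) : IsClosed (cornerSeq α hα n : Set A) := isClosed_corner _ _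

/-- The natural homomorphism `B_n → B`. -/
noncomputable def stageHom (n : ℕ) : Stage α hα J n →⋆ₙₐ[ℂ] NatExt α hα J :=
  dirLimOf (X := fun n => Stage α hα J n) (bond α hα J) n

/-- The homomorphism `A_n → B_n`, `a ↦ 0 ⊕ … ⊕ 0 ⊕ a`. -/
noncomputable def lastHom (n : ℕ) : cornerSeq α hα n →⋆ₙₐ[ℂ] Stage α hα J n where
  toFun a := ⟨(0, a), fun _ => zero_mem _, a.2⟩
  map_smul' _ _ := Subtype.ext (Prod.ext (smul_zero _).symm rfl)
  map_zero' := rfl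
  map_add' _ _ := Subtype.ext (Prod.ext (add_zero _).symm rfl)
  map_mul' _ _ := Subtype.ext (Prod.ext (mul_zero _).symm rfl)
  map_star' _ := Subtype.ext (Prod.ext (star_zero _).symm rfl)

/-- The homomorphism `A_n → B_n → B` given by the last summand of `B_n`. For the complete transfer
operator `β_*` of `(B, β)` it is `a ↦ β_*ⁿ(T(a))`. -/
noncomputable def gen (n : ℕ) : cornerSeq α hα n →⋆ₙₐ[ℂ] NatExt α hα J :=
  (stageHom α hα J n).comp (lastHom α hα J n)

theorem stageHom_bond (n : ℕ) (x : Stage α hα J n) :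
    stageHom α hα J (n + 1) (bond α hα J n x) = stageHom α hα J n x :=
  dirLimOf_bond (X := fun n => Stage α hα J n) (bond α hα J) n x

theorem natEndo_stageHom (n : ℕ) (x : Stage α hα J n) :
    natEndo α hα J (stageHom α hα J n x) = stageHom α hα J n (stageEndo α hα J n x) :=
  dirLimMap_dirLimOf (X := fun n => Stage α hα J n) (bond α hα J) (stageEndo α hα J)
    (bond_stageEndo α hα J) n x

theorem natEmb_eq_stageHom (a : A) :
    natEmb α hα J a = stageHom α hα J 0 (toStageZero α hα J a) :=
  (dirLimOf_zero (X := fun n => Stage α hα J n) (bond α hα J) (toStageZero α hα J a)).symm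

theorem mem_cornerSeq_zero (a : A) : a ∈ cornerSeq α hα 0 := ⟨rfl, rfl⟩

theorem natEmb_eq_gen (a : A) : natEmb α hα J a = gen α hα J 0 ⟨a, mem_cornerSeq_zero α hα a⟩ := by
  rw [natEmb_eq_stageHom]
  exact congrArg _ (Subtype.ext (Prod.ext (Subsingleton.elim _ _) rfl))

/-- This is the only place where `J ⊆ (ker α)^⊥` enters the structure of `B`: the map
`a ↦ q(a) ⊕ α(a)` has kernel `J ∩ ker α = 0`. -/
theorem bond_injective (hJ : (J.toSubmodule : Set A) ⊆ kerPerp α) (n : ℕ) :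
    Function.Injective (bond α hα J n) := by
  refine (injective_iff_map_eq_zero _).mpr fun x hx => ?_
  obtain ⟨⟨x, a⟩, h⟩ := x
  have h0 : bondAmb α J n (x, a) = 0 := congrArg Subtype.val hx
  have h1 : Fin.snoc (α := fun _ => J.Quot) x (J.q a) = 0 := congrArg Prod.fst h0
  have h2 : α a = 0 := congrArg Prod.snd h0
  have h3 : J.q a = J.q 0 := by
    have := congrFun h1 (Fin.last n)
    rw [Fin.snoc_last] at this
    rw [this, map_zero]; rfl
  rw [ClosedIdeal.q_eq, sub_zero] at h3
  have h4 : a = 0 := kerPerp_eq_zero (hJ h3) h2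
  have h5 : x = 0 := funext fun k => by
    have := congrFun h1 k.castSucc
    rwa [Fin.snoc_castSucc] at this
  subst h4 h5
  rfl

theorem norm_stageHom (hJ : (J.toSubmodule : Set A) ⊆ kerPerp α) (n : ℕ) (x : Stage α hα J n) :
    ‖stageHom α hα J n x‖ = ‖x‖ :=
  norm_dirLimOf (X := fun n => Stage α hα J n) (bond α hα J) (bond_injective α hα J hJ) n x

theorem natEmb_injective (hJ : (J.toSubmodule : Set A) ⊆ kerPerp α) :
    Function.Injective (natEmb α hα J) := by
  refine (injective_iff_map_eq_zero _).mpr fun a ha => ?_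
  rw [natEmb_eq_stageHom, ← norm_eq_zero, norm_stageHom α hα J hJ, norm_eq_zero] at ha
  exact congrArg (fun x : Stage α hα J 0 => x.1.2) ha

/-- `B_{n+1}` is spanned by the images of `B_n` and of `A_{n+1}`. -/
theorem exists_bond_add_last (n : ℕ) (x : Stage α hα J (n + 1)) :
    ∃ (y : Stage α hα J n) (a : cornerSeq α hα (n + 1)),
      x = bond α hα J n y + lastHom α hα J (n + 1) a := by
  obtain ⟨⟨x, a⟩, hx, ha⟩ := x
  obtain ⟨b, hb, hb'⟩ := hx (Fin.last n)
  have hb'' : J.q b = x (Fin.last n) := hb'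
  refine ⟨⟨(fun k => x k.castSucc, b), fun k => hx k.castSucc, hb⟩,
    ⟨a - α b, sub_mem ha (map_mem_cornerSeq α hα n hb)⟩, Subtype.ext (Prod.ext ?_ ?_)⟩
  · funext k
    change x k = Fin.snoc (α := fun _ => J.Quot) (fun k => x k.castSucc) (J.q b) k + 0
    refine Fin.lastCases ?_ (fun i => ?_) k
    · rw [Fin.snoc_last, add_zero, hb'']
    · rw [Fin.snoc_castSucc, add_zero]
  · exact (add_sub_cancel _ _).symm

/-- A closed subspace of `B` containing all generators is everything. -/
theorem natExt_induction {P : Submodule ℂ (NatExt α hα J)} (hP : IsClosed (P : Set (NatExt α hα J)))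
    (h : ∀ n a, gen α hα J n a ∈ P) (b : NatExt α hα J) : b ∈ P := by
  refine dirLim_induction (X := fun n => Stage α hα J n) (bond α hα J) (P := (· ∈ P)) hP ?_ b
  intro n
  change ∀ x, stageHom α hα J n x ∈ P
  induction n with
  | zero =>
    intro x
    have : x = lastHom α hα J 0 ⟨x.1.2, mem_cornerSeq_zero α hα _⟩ :=
      Subtype.ext (Prod.ext (Subsingleton.elim _ _) rfl)
    rw [this]
    exact h 0 _
  | succ n ih =>
    intro x
    obtain ⟨y, a, rfl⟩ := exists_bond_add_last α hα J n x
    rw [map_add, stageHom_bond]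
    exact add_mem (ih y) (h (n + 1) a)

theorem stageEndo_last (n : ℕ) (a : A) (ha : a ∈ cornerSeq α hα (n + 1)) :
    stageEndo α hα J (n + 1) (lastHom α hα J (n + 1) ⟨a, ha⟩) =
      bond α hα J n (lastHom α hα J n ⟨a, cornerSeq_succ_le α hα n ha⟩) := by
  refine Subtype.ext (Prod.ext (funext fun k => ?_) rfl)
  change Fin.snoc (α := fun _ => J.Quot) (0 : Fin (n + 1) → J.Quot) (J.q a) k.succ =
    Fin.snoc (α := fun _ => J.Quot) (0 : Fin n → J.Quot) (J.q a) k
  refine Fin.lastCases ?_ (fun i => ?_) k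
  · rw [Fin.succ_last, Fin.snoc_last, Fin.snoc_last]
  · rw [Fin.succ_castSucc, Fin.snoc_castSucc, Fin.snoc_castSucc]; rfl

theorem natEndo_gen_succ (n : ℕ) (a : A) (ha : a ∈ cornerSeq α hα (n + 1)) :
    natEndo α hα J (gen α hα J (n + 1) ⟨a, ha⟩) =
      gen α hα J n ⟨a, cornerSeq_succ_le α hα n ha⟩ := by
  change natEndo α hα J (stageHom α hα J (n + 1) (lastHom α hα J (n + 1) ⟨a, ha⟩)) = _
  rw [natEndo_stageHom, stageEndo_last, stageHom_bond]; rfl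

theorem natEmb_commutes (a : A) : natEmb α hα J (α a) = natEndo α hα J (natEmb α hα J a) := by
  rw [natEmb_eq_stageHom, natEmb_eq_stageHom, natEndo_stageHom]
  exact congrArg _ (Subtype.ext (Prod.ext (Subsingleton.elim _ _) rfl))

theorem iterate_mem_cornerSeq (n : ℕ) (a : A) : α^[n] a ∈ cornerSeq α hα n := by
  induction n with
  | zero => exact mem_cornerSeq_zero α hα a
  | succ n ih => rw [Function.iterate_succ_apply']; exact map_mem_cornerSeq α hα n ih

/-- The image of `T(a)` in `B_n` has last component `αⁿ(a)`. -/
theorem exists_stage_natEmb (n : ℕ) (a : A) :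
    ∃ x : Stage α hα J n, stageHom α hα J n x = natEmb α hα J a ∧ x.1.2 = α^[n] a := by
  induction n with
  | zero => exact ⟨_, (natEmb_eq_stageHom α hα J a).symm, rfl⟩
  | succ n ih =>
    obtain ⟨x, h1, h2⟩ := ih
    refine ⟨bond α hα J n x, by rw [stageHom_bond, h1], ?_⟩
    rw [Function.iterate_succ_apply', ← h2]; rfl

theorem natEmb_mul_gen (n : ℕ) (v : A) (a : cornerSeq α hα n) :
    natEmb α hα J v * gen α hα J n a =
      gen α hα J n (⟨α^[n] v, iterate_mem_cornerSeq α hα n v⟩ * a) := by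
  obtain ⟨x, h1, h2⟩ := exists_stage_natEmb α hα J n v
  change _ * stageHom α hα J n (lastHom α hα J n a) = stageHom α hα J n (lastHom α hα J n _)
  rw [← h1, ← map_mul]
  refine congrArg _ (Subtype.ext (Prod.ext (mul_zero _) ?_))
  change x.1.2 * a = α^[n] v * a
  rw [h2]

/-- `T(αᵏ(u))` acts on `A_n ⊆ B_n` as `α^{n+k}(u)`, which tends to `ᾱ^{n+k}(1)` strictly. -/
theorem tendsto_natEmb_iterate_mul_gen (n k : ℕ) (a : cornerSeq α hα n)
    (h : (unitImage α hα (n + k)).fst a.1 ∈ cornerSeq α hα n) :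
    Tendsto (fun u => natEmb α hα J (α^[k] u) * gen α hα J n a) (approxUnit A)
      (𝓝 (gen α hα J n ⟨(unitImage α hα (n + k)).fst a.1, h⟩)) := by
  have h1 := (strictTendsto_approxUnit.iterate hα (n + k)).left a.1
  refine Tendsto.congr (fun u => (natEmb_mul_gen α hα J n _ a).symm)
    (((continuous_hom (gen α hα J n)).tendsto _).comp (tendsto_subtype_rng.mpr ?_))
  exact h1.congr fun u => by rw [Function.iterate_add_apply]; rfl

/-- The images `T(u)` of an approximate unit of `A` converge strongly to the identity of `B`. -/
theorem tendsto_natEmb_mul (b : NatExt α hα J) :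
    Tendsto (fun u => natEmb α hα J u * b) (approxUnit A) (𝓝 b) := by
  let N : Submodule ℂ (NatExt α hα J) :=
    { carrier := {y | Tendsto (fun u => natEmb α hα J u * y) (approxUnit A) (𝓝 y)}
      add_mem' := fun hx hy => (hx.add hy).congr fun u => (mul_add _ _ _).symm
      zero_mem' := by simp
      smul_mem' := fun c x hx => (hx.const_smul c).congr fun u => (mul_smul_comm _ _ _).symm }
  refine natExt_induction α hα J (P := N) (isClosed_setOf_fixed (natEmb α hα J)) (fun n a => ?_) b
  have h := tendsto_natEmb_iterate_mul_gen α hα J n 0 a (by rw [add_zero, a.2.1]; exact a.2)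
  have e : (⟨(unitImage α hα (n + 0)).fst a.1, by rw [add_zero, a.2.1]; exact a.2⟩ :
      cornerSeq α hα n) = a := Subtype.ext a.2.1
  rw [e] at h
  exact h

theorem natEmb_nondegenerate :
    (Submodule.span ℂ {x | ∃ a b, x = natEmb α hα J a * b}).topologicalClosure = ⊤ :=
  nondegenerate_of_tendsto (tendsto_natEmb_mul α hα J)

theorem unitImage_fst_mem (n : ℕ) (a : cornerSeq α hα n) :
    (unitImage α hα (n + 1)).fst a.1 ∈ cornerSeq α hα n := by
  have h1 := congrArg (fun m : 𝓜(ℂ, A) => m.fst a.1) (unitImage_mul_succ α hα n).1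
  refine ⟨h1, ?_⟩
  rw [← fst_snd_comm, a.2.2]

theorem extendible_natEndo : Extendible (natEndo α hα J) := by
  have hconv : ∀ b, ∃ y, Tendsto (fun u => natEndo α hα J (natEmb α hα J u) * b) (approxUnit A)
      (𝓝 y) := by
    let N : Submodule ℂ (NatExt α hα J) :=
      { carrier := {b | ∃ y, Tendsto (fun u => natEndo α hα J (natEmb α hα J u) * b)
          (approxUnit A) (𝓝 y)}
        add_mem' := fun ⟨y, hy⟩ ⟨z, hz⟩ => ⟨y + z, (hy.add hz).congr fun u => (mul_add _ _ _).symm⟩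
        zero_mem' := ⟨0, by simp⟩
        smul_mem' := fun c x ⟨y, hy⟩ =>
          ⟨c • y, (hy.const_smul c).congr fun u => (mul_smul_comm _ _ _).symm⟩ }
    refine natExt_induction α hα J (P := N) (isClosed_setOf_convergent ?_) fun n a => ?_
    · exact approxUnit_norm.mono fun u hu => (norm_map_le _ _).trans ((norm_map_le _ _).trans hu)
    · have h := tendsto_natEmb_iterate_mul_gen α hα J n 1 a (unitImage_fst_mem α hα n a)
      exact ⟨_, h.congr fun u => by rw [Function.iterate_one, natEmb_commutes]⟩
  refine extendible_of_hasFactor fun b => ?_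
  obtain ⟨y, hy⟩ := hconv b
  exact exists_factor_of_tendsto (natEndo α hα J)
    (strictTendsto_of_nondegenerate (natEmb_nondegenerate α hα J)).right hy

theorem isMorphism_natEmb : IsMorphism α (natEndo α hα J) (natEmb α hα J) :=
  ⟨natEmb_nondegenerate α hα J, natEmb_commutes α hα J⟩

/-! ### The transfer operator of `(B, β)` -/

/-- The zeroth coordinate `B_n → A/J`; on `B_0 = A` it is the quotient map. -/
noncomputable def slotZero (n : ℕ) : Stage α hα J n →⋆ₙₐ[ℂ] J.Quot where
  toFun x := (bond α hα J n x).1.1 0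
  map_smul' c x := by rw [map_smul]; rfl
  map_zero' := by rw [map_zero]; rfl
  map_add' x y := by rw [map_add]; rfl
  map_mul' x y := by rw [map_mul]; rfl
  map_star' x := by rw [map_star]; rfl

theorem slotZero_bond (n : ℕ) (x : Stage α hα J n) :
    slotZero α hα J (n + 1) (bond α hα J n x) = slotZero α hα J n x := by
  change Fin.snoc (α := fun _ => J.Quot) (bond α hα J n x).1.1 (J.q (bond α hα J n x).1.2)
    (Fin.castSucc 0) = _
  rw [Fin.snoc_castSucc]; rfl

/-- On `B_n`, the pair of `β` and the zeroth coordinate carries the same information as the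
bonding map `T_n`. -/
theorem endo_slotZero_injective (hJ : (J.toSubmodule : Set A) ⊆ kerPerp α) (n : ℕ) :
    Function.Injective (((natEndo α hα J).comp (stageHom α hα J n)).prod (slotZero α hα J n)) := by
  refine (injective_iff_map_eq_zero _).mpr fun x hx => ?_
  have h1 : natEndo α hα J (stageHom α hα J n x) = 0 := congrArg Prod.fst hx
  have h2 : (bond α hα J n x).1.1 0 = 0 := congrArg Prod.snd hx
  rw [natEndo_stageHom, ← norm_eq_zero, norm_stageHom α hα J hJ, norm_eq_zero] at h1
  have h3 : endoAmb α J n x.1 = 0 := congrArg Subtype.val h1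
  have h4 : (endoAmb α J n x.1).2 = 0 := congrArg Prod.snd h3
  refine bond_injective α hα J hJ n ?_
  rw [map_zero]
  refine Subtype.ext (Prod.ext (funext fun k => ?_) h4)
  refine Fin.cases h2 (fun i => ?_) k
  exact congrFun (congrArg Prod.fst h3) i

/-- The homomorphism `B → B ⊕ A/J` consisting of `β` and the zeroth coordinate. -/
noncomputable def endoSlot : NatExt α hα J →⋆ₙₐ[ℂ] NatExt α hα J × J.Quot :=
  dirLimLift (X := fun n => Stage α hα J n) (bond α hα J)
    (fun n => ((natEndo α hα J).comp (stageHom α hα J n)).prod (slotZero α hα J n))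
    fun n x => Prod.ext (congrArg (natEndo α hα J) (stageHom_bond α hα J n x))
      (slotZero_bond α hα J n x)

theorem endoSlot_stageHom (n : ℕ) (x : Stage α hα J n) :
    endoSlot α hα J (stageHom α hα J n x) =
      (natEndo α hα J (stageHom α hα J n x), slotZero α hα J n x) :=
  dirLimLift_of (X := fun n => Stage α hα J n) (bond α hα J) _ _ n x

theorem endoSlot_injective (hJ : (J.toSubmodule : Set A) ⊆ kerPerp α) :
    Function.Injective (endoSlot α hα J) :=
  dirLimLift_injective (X := fun n => Stage α hα J n) (bond α hα J) _ _
    (endo_slotZero_injective α hα J hJ)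

theorem endoSlot_fst (b : NatExt α hα J) : (endoSlot α hα J b).1 = natEndo α hα J b := by
  refine dirLim_induction (X := fun n => Stage α hα J n) (bond α hα J)
    (P := fun b => (endoSlot α hα J b).1 = natEndo α hα J b)
    (isClosed_eq (continuous_fst.comp (continuous_hom _)) (continuous_hom _)) (fun n x => ?_) b
  exact congrArg Prod.fst (endoSlot_stageHom α hα J n x)

theorem slotZero_last_succ (n : ℕ) (a : cornerSeq α hα (n + 1)) :
    slotZero α hα J (n + 1) (lastHom α hα J (n + 1) a) = 0 := by
  change Fin.snoc (α := fun _ => J.Quot) (0 : Fin (n + 1) → J.Quot) (J.q a.1)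
    (Fin.castSucc 0) = _
  rw [Fin.snoc_castSucc]; rfl

/-- The generators from `A_{n+1}` have zeroth coordinate `0`, so their products with elements of
`ker β` vanish under the injective map `B → B ⊕ A/J`. -/
theorem gen_succ_mem_kerPerp (hJ : (J.toSubmodule : Set A) ⊆ kerPerp α) (n : ℕ)
    (a : cornerSeq α hα (n + 1)) : gen α hα J (n + 1) a ∈ kerPerp (natEndo α hα J) := by
  intro c hc
  apply endoSlot_injective α hα J hJ
  have h1 : (endoSlot α hα J (gen α hα J (n + 1) a)).2 = 0 :=
    (congrArg Prod.snd (endoSlot_stageHom α hα J _ _)).trans (slotZero_last_succ α hα J n a)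
  have h2 : (endoSlot α hα J c).1 = 0 := (endoSlot_fst α hα J c).trans hc
  rw [map_mul, map_zero]
  exact Prod.ext (by rw [Prod.fst_mul, h2, mul_zero]; rfl) (by rw [Prod.snd_mul, h1, zero_mul]; rfl)

/-- The compression by `β̄(1)` acts on the image of `A_n` as the compression by `ᾱ^{n+1}(1)`. -/
theorem compress_gen (hβ : Extendible (natEndo α hα J)) (n : ℕ) (a : cornerSeq α hα n) :
    ∃ a' : A, ∃ ha' : a' ∈ cornerSeq α hα (n + 1),
      compress hβ (gen α hα J n a) = gen α hα J n ⟨a', cornerSeq_succ_le α hα n ha'⟩ := by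
  have hfst : ∀ a : cornerSeq α hα n, (hβ.ext 1).fst (gen α hα J n a) =
      gen α hα J n ⟨_, unitImage_fst_mem α hα n a⟩ := fun a => by
    have h := tendsto_natEmb_iterate_mul_gen α hα J n 1 a (unitImage_fst_mem α hα n a)
    refine tendsto_nhds_unique ?_ h
    have h1 := (hβ.ext_spec.strictTendsto
      (strictTendsto_of_nondegenerate (natEmb_nondegenerate α hα J))).left (gen α hα J n a)
    exact h1.congr fun u => by rw [Function.iterate_one, natEmb_commutes]
  have hp := isStarProjection_ext_one hβ
  set b : cornerSeq α hα n := star ⟨_, unitImage_fst_mem α hα n (star a)⟩ with hb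
  have hsnd : (hβ.ext 1).snd (gen α hα J n a) = gen α hα J n b := by
    rw [← star_star ((hβ.ext 1).snd _), projection_star_snd hp, ← map_star (gen α hα J n), hfst,
      ← map_star (gen α hα J n)]
  refine ⟨(unitImage α hα (n + 1)).fst b.1, ?_, by rw [compress, hsnd, hfst]⟩
  have hP := isStarProjection_unitImage α hα (n + 1)
  refine mem_corner_iff_exists.mpr ⟨a.1, congrArg _ ?_⟩
  change _ = star ((unitImage α hα (n + 1)).fst (star a.1))
  rw [projection_star_fst hP, star_star]

theorem exists_preimage_compress (hJ : (J.toSubmodule : Set A) ⊆ kerPerp α)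
    (hβ : Extendible (natEndo α hα J)) (b : NatExt α hα J) :
    ∃ d ∈ kerPerp (natEndo α hα J), natEndo α hα J d = compress hβ b := by
  let K := kerPerpIdeal (natEndo α hα J)
  let N : Submodule ℂ (NatExt α hα J) :=
    { carrier := {b | ∃ d ∈ kerPerp (natEndo α hα J), natEndo α hα J d = compress hβ b}
      add_mem' := fun ⟨d, hd, h⟩ ⟨d', hd', h'⟩ => ⟨d + d', K.toSubmodule.add_mem hd hd', by
        simp only [map_add, h, h', compress]⟩
      zero_mem' := ⟨0, K.toSubmodule.zero_mem, by simp [compress]⟩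
      smul_mem' := fun c x ⟨d, hd, h⟩ => ⟨c • d, K.toSubmodule.smul_mem c hd, by
        simp only [map_smul, h, compress]⟩ }
  refine natExt_induction α hα J (P := N) (isClosed_setOf_compress_mem hβ) (fun n a => ?_) b
  obtain ⟨a', ha', h⟩ := compress_gen α hα J hβ n a
  exact ⟨_, gen_succ_mem_kerPerp α hα J hJ n ⟨a', ha'⟩, by rw [h, natEndo_gen_succ]⟩

end NaturalExtension

/-! ### `(B, β)` is a reversible `J`-extension generated by `A` -/

section Reversible

variable {A : Type*} [NonUnitalCStarAlgebra A] (α : A →⋆ₙₐ[ℂ] A) (hα : Extendible α)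
  (J : ClosedIdeal A)

theorem isReversible_natEndo (hJ : (J.toSubmodule : Set A) ⊆ kerPerp α) :
    IsReversible (natEndo α hα J) :=
  ⟨extendible_natEndo α hα J,
    exists_completeTransferOperator _ (exists_preimage_compress α hα J hJ _)⟩

theorem mem_iff_natEmb_mem_kerPerp (hJ : (J.toSubmodule : Set A) ⊆ kerPerp α) (a : A) :
    a ∈ J.toSubmodule ↔ natEmb α hα J a ∈ kerPerp (natEndo α hα J) := by
  have hT : ∀ a, natEmb α hα J a =
      gen α hα J 0 ⟨a, mem_cornerSeq_zero α hα a⟩ := natEmb_eq_gen α hα J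
  have hα1 : ∀ a, α a ∈ cornerSeq α hα 1 := fun a =>
    map_mem_cornerSeq α hα 0 (mem_cornerSeq_zero α hα a)
  constructor
  · intro ha
    -- `T(a) = q(a) ⊕ α(a)` in `B_1`, and `q(a) = 0`.
    have e : natEmb α hα J a = gen α hα J 1 ⟨α a, hα1 a⟩ := by
      rw [natEmb_eq_stageHom, ← stageHom_bond]
      refine congrArg _ (Subtype.ext (Prod.ext (funext fun k => ?_) rfl))
      have h0 : J.q a = 0 := by rw [← map_zero J.q, ClosedIdeal.q_eq, sub_zero]; exact ha
      obtain rfl : k = Fin.last 0 := Fin.ext (by omega)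
      change Fin.snoc (α := fun _ => J.Quot) (toStageZero α hα J a).1.1 (J.q a) (Fin.last 0) = 0
      rw [Fin.snoc_last, h0]
    rw [e]
    exact gen_succ_mem_kerPerp α hα J hJ 0 _
  · intro ha
    -- The element `T(a*) - gen 1 (α(a*))` has the single non-zero slot `q(a*)`: it lies in `ker β`.
    have hc : natEndo α hα J (natEmb α hα J (star a) -
        gen α hα J 1 ⟨α (star a), hα1 _⟩) = 0 := by
      rw [map_sub, natEndo_gen_succ, ← natEmb_commutes, hT, sub_self]
    have h1 := ha _ hc
    have h2 : natEmb α hα J a * gen α hα J 1 ⟨α (star a), hα1 _⟩ =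
        gen α hα J 1 ⟨α (a * star a), hα1 _⟩ := by
      rw [natEmb_mul_gen]
      exact congrArg _ (Subtype.ext (map_mul α _ _).symm)
    rw [mul_sub, h2, ← map_mul, sub_eq_zero] at h1
    have h3 := congrArg (fun b => (endoSlot α hα J b).2) h1
    have h4 : (endoSlot α hα J (natEmb α hα J (a * star a))).2 = J.q (a * star a) := by
      rw [natEmb_eq_stageHom, endoSlot_stageHom]; rfl
    have h5 : (endoSlot α hα J (gen α hα J 1 ⟨α (a * star a), hα1 _⟩)).2 = 0 :=
      (congrArg Prod.snd (endoSlot_stageHom α hα J _ _)).trans (slotZero_last_succ α hα J 0 _)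
    have h6 : J.q a * star (J.q a) = 0 := by
      rw [← map_star, ← map_mul, ← h4, ← h5]; exact h3
    have h7 := (CStarRing.mul_star_self_eq_zero_iff _).mp h6
    rwa [← map_zero J.q, ClosedIdeal.q_eq, sub_zero] at h7

theorem isReversibleExtension_natEmb (hJ : (J.toSubmodule : Set A) ⊆ kerPerp α) :
    IsReversibleExtension α (J.toSubmodule : Set A) (natEndo α hα J) (natEmb α hα J) where
  reversible := isReversible_natEndo α hα J hJ
  embedding :=
    { toIsMorphism := isMorphism_natEmb α hα J
      injective := natEmb_injective α hα J hJ
      preimage_eq := Set.ext fun a => mem_iff_natEmb_mem_kerPerp α hα J hJ a }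

variable {α hα J} {hβ : Extendible (natEndo α hα J)} {L : NatExt α hα J →ₗ[ℂ] NatExt α hα J}

theorem iterate_transfer_natEmb (hJ : (J.toSubmodule : Set A) ⊆ kerPerp α)
    (hL : IsCompleteTransferOperator (natEndo α hα J) hβ L) (n : ℕ) (a : A)
    (ha : a ∈ cornerSeq α hα n) : L^[n] (natEmb α hα J a) = gen α hα J n ⟨a, ha⟩ := by
  induction n with
  | zero => exact natEmb_eq_gen α hα J a
  | succ n ih =>
    rw [Function.iterate_succ_apply', ih (cornerSeq_succ_le α hα n ha)]
    refine hL.eq_of_mem (gen_succ_mem_kerPerp α hα J hJ n _) ?_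
    rw [← natEndo_gen_succ α hα J n a ha, compress_map]

theorem isGeneratedBy_natEmb (hJ : (J.toSubmodule : Set A) ⊆ kerPerp α) :
    IsGeneratedBy (J.toSubmodule : Set A) (natEndo α hα J) (natEmb α hα J) := by
  obtain ⟨hβ, L, hL⟩ := isReversible_natEndo α hα J hJ
  obtain ⟨Lbar, hLbar⟩ := hL.exists_strictExtension
  refine ⟨hβ, L, Lbar, hL, hLbar, eq_top_iff.mpr fun b _ => ?_, Set.ext fun a => ?_⟩
  · refine natExt_induction α hα J (Submodule.isClosed_topologicalClosure _) (fun n a => ?_) b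
    exact Submodule.le_topologicalClosure _ (Submodule.subset_span
      ⟨n, a.1, (iterate_transfer_natEmb hJ hL n a.1 a.2).symm⟩)
  · rw [Set.mem_ofPred_eq, hL.strictExtension_one_apply hLbar, hL.apply_map_eq_iff]
    exact mem_iff_natEmb_mem_kerPerp α hα J hJ a

end Reversible

/-! ### The universal property -/

section CornerTransfer

variable {C : Type*} [NonUnitalCStarAlgebra C] {γ : C →⋆ₙₐ[ℂ] C} {hγ : Extendible γ}
  {M : C →ₗ[ℂ] C}

theorem compress_of_mem_cornerSeq {n : ℕ} {y : C} (hy : y ∈ cornerSeq γ hγ (n + 1)) :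
    compress hγ y = y := by
  have h1 : y ∈ cornerSeq γ hγ 1 := by
    induction n with
    | zero => exact hy
    | succ n ih => exact ih (cornerSeq_succ_le γ hγ (n + 1) hy)
  exact (congrArg _ h1.2).trans h1.1

theorem transfer_mem_cornerSeq (hM : IsCompleteTransferOperator γ hγ M) {n : ℕ} {y : C}
    (hy : y ∈ cornerSeq γ hγ (n + 1)) : M y ∈ cornerSeq γ hγ n := by
  have h1 : γ (M y) = y := (hM.map_apply y).trans (compress_of_mem_cornerSeq hy)
  have hK := hM.mem_kerPerp y
  have hp : unitImage γ hγ (n + 1) = hγ.ext (unitImage γ hγ n) :=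
    Function.iterate_succ_apply' _ _ _
  constructor
  · refine kerPerp_ext ((kerPerpIdeal γ).fst_mem _ hK) hK ?_
    rw [hγ.map_fst, ← hp, h1, hy.1]
  · refine kerPerp_ext ((kerPerpIdeal γ).snd_mem _ hK) hK ?_
    rw [hγ.map_snd, ← hp, h1, hy.2]

theorem iterate_transfer_mem_cornerSeq (hM : IsCompleteTransferOperator γ hγ M) (j : ℕ) {n : ℕ}
    {y : C} (hy : y ∈ cornerSeq γ hγ (n + j)) : M^[j] y ∈ cornerSeq γ hγ n := by
  induction j generalizing n with
  | zero => exact hy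
  | succ j ih =>
    rw [Function.iterate_succ_apply']
    exact transfer_mem_cornerSeq hM (ih (by rwa [add_right_comm]))

theorem iterate_map_transfer (hM : IsCompleteTransferOperator γ hγ M) (k j : ℕ) {y : C}
    (hy : y ∈ cornerSeq γ hγ (k + j)) : γ^[k] (M^[j + k] y) = M^[j] y := by
  induction k generalizing j with
  | zero => rfl
  | succ k ih =>
    have e : j + (k + 1) = (j + 1) + k := by omega
    rw [Function.iterate_succ_apply', e, ih (j + 1) (by rwa [← add_assoc, add_right_comm]),
      Function.iterate_succ_apply', hM.map_apply]
    exact compress_of_mem_cornerSeq (n := k) (iterate_transfer_mem_cornerSeq hM j hy)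

end CornerTransfer

section Universal

/-- The composite `F⁻¹ ∘ G`, for `F` injective with range containing that of `G`. -/
noncomputable def homThrough {X C D : Type*} [NonUnitalCStarAlgebra X] [NonUnitalCStarAlgebra C]
    [NonUnitalCStarAlgebra D] (F : C →⋆ₙₐ[ℂ] D) (hF : Function.Injective F) (G : X →⋆ₙₐ[ℂ] D)
    (h : ∀ x, ∃ c, F c = G x) : X →⋆ₙₐ[ℂ] C :=
  have spec := fun x => (h x).choose_spec
  { toFun := fun x => (h x).choose
    map_smul' := fun c x => hF <| by rw [spec, map_smul, MonoidHom.id_apply, map_smul, spec]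
    map_zero' := hF <| by rw [spec, map_zero, map_zero]
    map_add' := fun x y => hF <| by rw [spec, map_add, map_add, spec, spec]
    map_mul' := fun x y => hF <| by rw [spec, map_mul, map_mul, spec, spec]
    map_star' := fun x => hF <| by rw [spec, map_star, map_star, spec] }

theorem homThrough_spec {X C D : Type*} [NonUnitalCStarAlgebra X] [NonUnitalCStarAlgebra C]
    [NonUnitalCStarAlgebra D] (F : C →⋆ₙₐ[ℂ] D) (hF : Function.Injective F) (G : X →⋆ₙₐ[ℂ] D)
    (h : ∀ x, ∃ c, F c = G x) (x : X) : F (homThrough F hF G h x) = G x :=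
  (h x).choose_spec

variable {A C : Type*} [NonUnitalCStarAlgebra A] [NonUnitalCStarAlgebra C]

/-- The iterate `γⁿ`, as a homomorphism. -/
noncomputable def iterHom (γ : C →⋆ₙₐ[ℂ] C) : ℕ → C →⋆ₙₐ[ℂ] C
  | 0 => NonUnitalStarAlgHom.id ℂ C
  | n + 1 => γ.comp (iterHom γ n)

theorem iterHom_apply (γ : C →⋆ₙₐ[ℂ] C) (n : ℕ) (c : C) : iterHom γ n c = γ^[n] c := by
  induction n with
  | zero => rfl
  | succ n ih => rw [Function.iterate_succ_apply', ← ih]; rfl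

/-- The components of an element `c` of a reversible system: the classes of
`c, γ(c), …, γ^{n-1}(c)` modulo `(ker γ)^⊥`, and `γⁿ(c)`. -/
noncomputable def components (γ : C →⋆ₙₐ[ℂ] C) (n : ℕ) :
    C →⋆ₙₐ[ℂ] (Fin n → (kerPerpIdeal γ).Quot) × C where
  toFun c := (fun k => (kerPerpIdeal γ).q (iterHom γ k c), iterHom γ n c)
  map_smul' z c := by simp only [map_smul]; rfl
  map_zero' := by simp only [map_zero]; rfl
  map_add' c d := by simp only [map_add]; rfl
  map_mul' c d := by simp only [map_mul]; rfl
  map_star' c := by simp only [map_star]; rfl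

theorem components_injective (γ : C →⋆ₙₐ[ℂ] C) (n : ℕ) : Function.Injective (components γ n) := by
  refine (injective_iff_map_eq_zero _).mpr fun c hc => ?_
  have h1 : ∀ k : Fin n, iterHom γ k c ∈ kerPerp γ := fun k => by
    have : (kerPerpIdeal γ).q (iterHom γ k c) = 0 := congrFun (congrArg Prod.fst hc) k
    rwa [← map_zero (kerPerpIdeal γ).q, ClosedIdeal.q_eq, sub_zero] at this
  have h2 : iterHom γ n c = 0 := congrArg Prod.snd hc
  clear hc
  induction n with
  | zero => exact h2
  | succ n ih => exact ih (fun k => h1 k.castSucc) (kerPerp_eq_zero (h1 (Fin.last n)) h2)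

variable (α : A →⋆ₙₐ[ℂ] A) (hα : Extendible α) (J : ClosedIdeal A) {γ : C →⋆ₙₐ[ℂ] C}
  {S : A →⋆ₙₐ[ℂ] C}

/-- The homomorphism `A/J → C/(ker γ)^⊥` induced by a `J`-embedding. -/
noncomputable def quotHom (hS : IsCovariantEmbeddingOn α (J.toSubmodule : Set A) γ S) :
    J.Quot →⋆ₙₐ[ℂ] (kerPerpIdeal γ).Quot :=
  ClosedIdeal.mapQ J (kerPerpIdeal γ) S fun x hx =>
    (Set.ext_iff.mp hS.preimage_eq x).mp hx

theorem quotHom_q (hS : IsCovariantEmbeddingOn α (J.toSubmodule : Set A) γ S) (a : A) :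
    quotHom α J hS (J.q a) = (kerPerpIdeal γ).q (S a) := rfl

theorem quotHom_injective (hS : IsCovariantEmbeddingOn α (J.toSubmodule : Set A) γ S) :
    Function.Injective (quotHom α J hS) := by
  refine (injective_iff_map_eq_zero _).mpr fun x hx => ?_
  obtain ⟨a, rfl⟩ := J.q_surjective x
  rw [quotHom_q, ← map_zero (kerPerpIdeal γ).q, ClosedIdeal.q_eq, sub_zero] at hx
  rw [← map_zero J.q, ClosedIdeal.q_eq, sub_zero]
  exact (Set.ext_iff.mp hS.preimage_eq a).mpr hx

/-- The components that the image in `C` of an element of `B_n` has to have. -/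
noncomputable def stageComponents (hS : IsCovariantEmbeddingOn α (J.toSubmodule : Set A) γ S)
    (n : ℕ) : Stage α hα J n →⋆ₙₐ[ℂ] (Fin n → (kerPerpIdeal γ).Quot) × C where
  toFun x := (fun k => quotHom α J hS (x.1.1 k), S x.1.2)
  map_smul' z x := Prod.ext (funext fun k => map_smul (quotHom α J hS) z (x.1.1 k))
    (map_smul S z x.1.2)
  map_zero' := Prod.ext (funext fun _ => map_zero (quotHom α J hS)) (map_zero S)
  map_add' x y := Prod.ext (funext fun k => map_add (quotHom α J hS) (x.1.1 k) (y.1.1 k))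
    (map_add S x.1.2 y.1.2)
  map_mul' x y := Prod.ext (funext fun k => map_mul (quotHom α J hS) (x.1.1 k) (y.1.1 k))
    (map_mul S x.1.2 y.1.2)
  map_star' x := Prod.ext (funext fun k => map_star (quotHom α J hS) (x.1.1 k))
    (map_star S x.1.2)

variable (hS : IsCovariantEmbeddingOn α (J.toSubmodule : Set A) γ S)

theorem stageComponents_injective (n : ℕ) :
    Function.Injective (stageComponents α hα J hS n) := by
  refine (injective_iff_map_eq_zero _).mpr fun x hx => ?_
  refine Subtype.ext (Prod.ext (funext fun k => ?_) ?_)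
  · refine quotHom_injective α J hS (Eq.trans ?_ (map_zero _).symm)
    exact congrFun (congrArg Prod.fst hx) k
  · exact hS.injective (Eq.trans (congrArg Prod.snd hx) (map_zero S).symm)

theorem components_bond (n : ℕ) (x : Stage α hα J n) (c : C)
    (h : components γ n c = stageComponents α hα J hS n x) :
    components γ (n + 1) c = stageComponents α hα J hS (n + 1) (bond α hα J n x) := by
  have h2 : iterHom γ n c = S x.1.2 := congrArg Prod.snd h
  refine Prod.ext (funext fun k => ?_) ?_
  · change (kerPerpIdeal γ).q (iterHom γ k c) =
      quotHom α J hS (Fin.snoc (α := fun _ => J.Quot) x.1.1 (J.q x.1.2) k)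
    refine Fin.lastCases ?_ (fun i => ?_) k
    · rw [Fin.snoc_last, quotHom_q, ← h2]; rfl
    · rw [Fin.snoc_castSucc]
      exact congrFun (congrArg Prod.fst h) i
  · change γ (iterHom γ n c) = S (α x.1.2)
    rw [h2, hS.commutes]

variable {hγ : Extendible γ} {M : C →ₗ[ℂ] C} (hM : IsCompleteTransferOperator γ hγ M)

theorem components_iterate_transfer (hM : IsCompleteTransferOperator γ hγ M) (n : ℕ)
    (a : cornerSeq α hα n) :
    components γ n (M^[n] (S a)) = stageComponents α hα J hS n (lastHom α hα J n a) := by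
  have hy : S a ∈ cornerSeq γ hγ n := hS.toIsMorphism.map_mem_cornerSeq hα hγ a.2
  refine Prod.ext (funext fun k => ?_) ?_
  · refine Eq.trans ?_ (map_zero (quotHom α J hS)).symm
    change (kerPerpIdeal γ).q (iterHom γ k (M^[n] (S a))) = 0
    obtain ⟨j, hj⟩ : ∃ j, n = (j + 1) + k := ⟨n - 1 - k, by omega⟩
    rw [← map_zero (kerPerpIdeal γ).q, ClosedIdeal.q_eq, sub_zero, iterHom_apply]
    have h1 : γ^[k] (M^[n] (S a)) = M^[j + 1] (S a) := by
      have := iterate_map_transfer hM k (j + 1) (y := S a) (by rwa [add_comm, ← hj])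
      rwa [← hj] at this
    rw [h1, Function.iterate_succ_apply']
    exact hM.mem_kerPerp _
  · change iterHom γ n (M^[n] (S a)) = S a
    rw [iterHom_apply]
    have := iterate_map_transfer hM n 0 hy
    rwa [zero_add] at this

theorem exists_components (hM : IsCompleteTransferOperator γ hγ M) (n : ℕ) (x : Stage α hα J n) :
    ∃ c, components γ n c = stageComponents α hα J hS n x := by
  induction n with
  | zero => exact ⟨S x.1.2, Prod.ext (Subsingleton.elim _ _) rfl⟩
  | succ n ih =>
    obtain ⟨y, a, rfl⟩ := exists_bond_add_last α hα J n x
    obtain ⟨c, hc⟩ := ih y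
    refine ⟨c + M^[n + 1] (S a), ?_⟩
    rw [map_add, map_add, components_bond α hα J hS n y c hc,
      components_iterate_transfer α hα J hS hM]

/-- The homomorphism `B_n → C` determined by a reversible `J`-extension. -/
noncomputable def stageLift (n : ℕ) : Stage α hα J n →⋆ₙₐ[ℂ] C :=
  homThrough (components γ n) (components_injective γ n) (stageComponents α hα J hS n)
    (exists_components α hα J hS hM n)

theorem components_stageLift (n : ℕ) (x : Stage α hα J n) :
    components γ n (stageLift α hα J hS hM n x) = stageComponents α hα J hS n x :=
  homThrough_spec _ _ _ _ x

theorem stageLift_injective (n : ℕ) : Function.Injective (stageLift α hα J hS hM n) := by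
  intro x y h
  have := congrArg (components γ n) h
  rw [components_stageLift, components_stageLift] at this
  exact stageComponents_injective α hα J hS n this

theorem stageLift_bond (n : ℕ) (x : Stage α hα J n) :
    stageLift α hα J hS hM (n + 1) (bond α hα J n x) = stageLift α hα J hS hM n x := by
  apply components_injective γ (n + 1)
  rw [components_stageLift]
  exact (components_bond α hα J hS n x _ (components_stageLift α hα J hS hM n x)).symm

/-- The homomorphism `B → C` determined by a reversible `J`-extension `(C, γ)`. -/
noncomputable def natLift : NatExt α hα J →⋆ₙₐ[ℂ] C :=
  dirLimLift (X := fun n => Stage α hα J n) (bond α hα J) (stageLift α hα J hS hM)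
    (stageLift_bond α hα J hS hM)

theorem natLift_injective : Function.Injective (natLift α hα J hS hM) :=
  dirLimLift_injective (X := fun n => Stage α hα J n) (bond α hα J) _ _
    (stageLift_injective α hα J hS hM)

theorem natLift_gen (n : ℕ) (a : cornerSeq α hα n) :
    natLift α hα J hS hM (gen α hα J n a) = M^[n] (S a) := by
  have h : natLift α hα J hS hM (gen α hα J n a) =
      stageLift α hα J hS hM n (lastHom α hα J n a) :=
    dirLimLift_of (X := fun n => Stage α hα J n) (bond α hα J) _ _ n _
  rw [h]
  apply components_injective γ n
  rw [components_stageLift, components_iterate_transfer α hα J hS hM]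

theorem natLift_natEmb (a : A) : natLift α hα J hS hM (natEmb α hα J a) = S a := by
  rw [natEmb_eq_gen, natLift_gen]; rfl

theorem natExt_hom_ext {F G : NatExt α hα J →⋆ₙₐ[ℂ] C}
    (h : ∀ n a, F (gen α hα J n a) = G (gen α hα J n a)) : F = G := by
  refine NonUnitalStarAlgHom.ext fun b => ?_
  exact natExt_induction α hα J
    (P := LinearMap.eqLocus (F : NatExt α hα J →ₗ[ℂ] C) (G : NatExt α hα J →ₗ[ℂ] C))
    (isClosed_eq (continuous_hom F) (continuous_hom G)) h b

theorem natLift_commutes (b : NatExt α hα J) :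
    natLift α hα J hS hM (natEndo α hα J b) = γ (natLift α hα J hS hM b) := by
  have h : (natLift α hα J hS hM).comp (natEndo α hα J) = γ.comp (natLift α hα J hS hM) := by
    refine natExt_hom_ext α hα J fun n a => ?_
    change natLift α hα J hS hM (natEndo α hα J (gen α hα J n a)) =
      γ (natLift α hα J hS hM (gen α hα J n a))
    obtain ⟨a, ha⟩ := a
    cases n with
    | zero =>
      have : gen α hα J 0 ⟨a, ha⟩ = natEmb α hα J a := (natEmb_eq_gen α hα J a).symm
      rw [this, ← natEmb_commutes, natLift_natEmb, natLift_natEmb, hS.commutes]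
    | succ n =>
      rw [natEndo_gen_succ, natLift_gen, natLift_gen, Function.iterate_succ_apply', hM.map_apply]
      have hy : S a ∈ cornerSeq γ hγ (n + 1) := hS.toIsMorphism.map_mem_cornerSeq hα hγ ha
      exact (compress_of_mem_cornerSeq (n := 0)
        (iterate_transfer_mem_cornerSeq hM n (by rwa [add_comm, add_comm 0 1] ))).symm
  exact DFunLike.congr_fun h b

theorem natLift_nondegenerate :
    (Submodule.span ℂ {x | ∃ b c, x = natLift α hα J hS hM b * c}).topologicalClosure = ⊤ :=
  nondegenerate_of_tendsto (e := fun u => natEmb α hα J u) (l := approxUnit A) fun c => by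
    simp only [natLift_natEmb]
    exact (strictTendsto_of_nondegenerate hS.nondegenerate).left c

theorem natLift_mem_kerPerp (hJ : (J.toSubmodule : Set A) ⊆ kerPerp α) {b : NatExt α hα J}
    (hb : b ∈ kerPerp (natEndo α hα J)) : natLift α hα J hS hM b ∈ kerPerp γ := by
  obtain ⟨hβ, L, hL⟩ := isReversible_natEndo α hα J hJ
  rw [← (hL.apply_map_eq_iff b).mpr hb]
  refine natExt_induction α hα J (P := (kerPerpIdeal γ).toSubmodule.comap
    ((natLift α hα J hS hM : NatExt α hα J →ₗ[ℂ] C) ∘ₗ L)) ?_ (fun n a => ?_) _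
  · exact (kerPerpIdeal γ).isClosed'.preimage
      ((continuous_hom (natLift α hα J hS hM)).comp hL.continuous)
  · obtain ⟨a', ha', h⟩ := compress_gen α hα J hβ n a
    have e : L (gen α hα J n a) = gen α hα J (n + 1) ⟨a', ha'⟩ :=
      hL.eq_of_mem (gen_succ_mem_kerPerp α hα J hJ n _) (by rw [h, natEndo_gen_succ])
    change natLift α hα J hS hM (L (gen α hα J n a)) ∈ kerPerp γ
    rw [e, natLift_gen, Function.iterate_succ_apply']
    exact hM.mem_kerPerp _

theorem isCovariantEmbedding_natLift (hJ : (J.toSubmodule : Set A) ⊆ kerPerp α) :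
    IsCovariantEmbedding (natEndo α hα J) γ (natLift α hα J hS hM) where
  nondegenerate := natLift_nondegenerate α hα J hS hM
  commutes := natLift_commutes α hα J hS hM
  injective := natLift_injective α hα J hS hM
  preimage_eq := by
    refine Set.Subset.antisymm (fun b hb => natLift_mem_kerPerp α hα J hS hM hJ hb)
      fun b hb c hc => natLift_injective α hα J hS hM ?_
    rw [map_mul, map_zero]
    exact hb _ (by rw [← natLift_commutes, hc, map_zero])

/-- Covariant embeddings intertwine transfer operators, hence are determined on `β_*ⁿ(T(A))`. -/
theorem covariantEmbedding_unique (hJ : (J.toSubmodule : Set A) ⊆ kerPerp α)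
    (hγ : IsReversible γ) {F G : NatExt α hα J →⋆ₙₐ[ℂ] C}
    (hF : IsCovariantEmbedding (natEndo α hα J) γ F)
    (hG : IsCovariantEmbedding (natEndo α hα J) γ G)
    (h : F.comp (natEmb α hα J) = G.comp (natEmb α hα J)) : F = G := by
  obtain ⟨hβ, L, hL⟩ := isReversible_natEndo α hα J hJ
  obtain ⟨hγ, M, hM⟩ := hγ
  have key : ∀ F : NatExt α hα J →⋆ₙₐ[ℂ] C, IsCovariantEmbedding (natEndo α hα J) γ F →
      ∀ n (a : cornerSeq α hα n), F (gen α hα J n a) = M^[n] (F (natEmb α hα J a)) :=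
    fun F hF n a => by
      rw [← iterate_transfer_natEmb hJ hL n a.1 a.2]
      exact Function.Semiconj.iterate_right (f := F) (hF.map_transfer hL hM) n _
  refine natExt_hom_ext α hα J fun n a => ?_
  rw [key F hF, key G hG]
  exact congrArg _ (DFunLike.congr_fun h a.1)

theorem isUniversalExtension_natEmb.{w, u₁} {A : Type u₁} [NonUnitalCStarAlgebra A]
    (α : A →⋆ₙₐ[ℂ] A) (hα : Extendible α) (J : ClosedIdeal A)
    (hJ : (J.toSubmodule : Set A) ⊆ kerPerp α) :
    IsUniversalExtension.{w} α (J.toSubmodule : Set A) (natEndo α hα J) (natEmb α hα J) := by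
  intro D _ δ R hR
  obtain ⟨hδ, M, hM⟩ := hR.reversible
  have h1 := isCovariantEmbedding_natLift α hα J hR.embedding hM hJ
  have h2 : (natLift α hα J hR.embedding hM).comp (natEmb α hα J) = R :=
    NonUnitalStarAlgHom.ext fun a => natLift_natEmb α hα J hR.embedding hM a
  exact ⟨_, ⟨h1, h2⟩, fun Φ hΦ =>
    covariantEmbedding_unique α hα J hJ hR.reversible hΦ.1 h1 (hΦ.2.trans h2.symm)⟩

end Universal

/-! ### Characterizations of `(B, β)` up to equivalence -/

section Characterization

variable {A C : Type*} [NonUnitalCStarAlgebra A] [NonUnitalCStarAlgebra C]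
  {α : A →⋆ₙₐ[ℂ] A} (hα : Extendible α) {J : ClosedIdeal A} {γ : C →⋆ₙₐ[ℂ] C} {S : A →⋆ₙₐ[ℂ] C}

theorem exists_equiv_of_surjective {W : NatExt α hα J →⋆ₙₐ[ℂ] C}
    (hW : IsCovariantEmbedding (natEndo α hα J) γ W) (hS : W.comp (natEmb α hα J) = S)
    (hsurj : Function.Surjective W) :
    ∃ W : NatExt α hα J ≃⋆ₐ[ℂ] C,
      (∀ b, W (natEndo α hα J b) = γ (W b)) ∧ ∀ a, W (natEmb α hα J a) = S a :=
  ⟨StarAlgEquiv.ofBijective W ⟨hW.injective, hsurj⟩, hW.commutes, DFunLike.congr_fun hS⟩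

theorem exists_equiv_of_isGeneratedBy (hJ : (J.toSubmodule : Set A) ⊆ kerPerp α)
    (hS : IsEmbedding α γ S) (hgen : IsGeneratedBy (J.toSubmodule : Set A) γ S) :
    ∃ W : NatExt α hα J ≃⋆ₐ[ℂ] C,
      (∀ b, W (natEndo α hα J b) = γ (W b)) ∧ ∀ a, W (natEmb α hα J a) = S a := by
  obtain ⟨hγ, M, Mbar, hM, hMbar, hspan, hJeq⟩ := hgen
  obtain ⟨hβ, L, hL⟩ := isReversible_natEndo α hα J hJ
  have hS' : IsCovariantEmbeddingOn α (J.toSubmodule : Set A) γ S :=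
    { toIsEmbedding := hS
      preimage_eq := by
        rw [hJeq]
        ext a
        rw [Set.mem_ofPred_eq, hM.strictExtension_one_apply hMbar, hM.apply_map_eq_iff]
        rfl }
  have hW := isCovariantEmbedding_natLift α hα J hS' hM hJ
  set W := natLift α hα J hS' hM with hWdef
  have hWS : W.comp (natEmb α hα J) = S :=
    NonUnitalStarAlgHom.ext fun a => natLift_natEmb α hα J hS' hM a
  refine exists_equiv_of_surjective hα hW hWS fun c => ?_
  have hclosed : IsClosed (Set.range W) :=
    (NonUnitalStarAlgHom.isometry W hW.injective).isClosedEmbedding.isClosed_range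
  have hle : (Submodule.span ℂ {b : C | ∃ (n : ℕ) (a : A), b = M^[n] (S a)}).topologicalClosure ≤
      LinearMap.range (W : NatExt α hα J →ₗ[ℂ] C) := by
    refine Submodule.topologicalClosure_minimal _ (Submodule.span_le.mpr ?_) ?_
    · rintro _ ⟨n, a, rfl⟩
      refine ⟨L^[n] (natEmb α hα J a), ?_⟩
      have := Function.Semiconj.iterate_right (f := W) (hW.map_transfer hL hM) n
        (natEmb α hα J a)
      exact this.trans (congrArg _ (DFunLike.congr_fun hWS a))
    · rw [LinearMap.coe_range]; exact hclosed
  rw [hspan] at hle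
  exact hle Submodule.mem_top

theorem exists_equiv_of_isUniversalExtension.{u₁, v₁} {A : Type u₁} {C : Type v₁}
    [NonUnitalCStarAlgebra A] [NonUnitalCStarAlgebra C] {α : A →⋆ₙₐ[ℂ] A} (hα : Extendible α)
    {J : ClosedIdeal A} (hJ : (J.toSubmodule : Set A) ⊆ kerPerp α) {γ : C →⋆ₙₐ[ℂ] C}
    {S : A →⋆ₙₐ[ℂ] C} (hγ : IsReversible γ) (hS : IsEmbedding α γ S)
    (huniv : IsUniversalExtension.{u₁} α (J.toSubmodule : Set A) γ S) :
    ∃ W : NatExt α hα J ≃⋆ₐ[ℂ] C,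
      (∀ b, W (natEndo α hα J b) = γ (W b)) ∧ ∀ a, W (natEmb α hα J a) = S a := by
  have hB := isReversibleExtension_natEmb α hα J hJ
  obtain ⟨Φ, ⟨hΦ, hΦS⟩, -⟩ := huniv (NatExt α hα J) (natEndo α hα J) (natEmb α hα J) hB
  -- `S⁻¹((ker γ)^⊥) = S⁻¹(Φ⁻¹((ker β)^⊥)) = T⁻¹((ker β)^⊥) = J`, so that `S` is a `J`-embedding.
  have hS' : IsReversibleExtension α (J.toSubmodule : Set A) γ S :=
    { reversible := hγ
      embedding :=
        { toIsEmbedding := hS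
          preimage_eq := by
            rw [hΦ.preimage_eq, hB.embedding.preimage_eq, ← hΦS]; rfl } }
  obtain ⟨W, ⟨hW, hWT⟩, -⟩ := isUniversalExtension_natEmb α hα J hJ C γ S hS'
  have hcomp : IsCovariantEmbedding (natEndo α hα J) (natEndo α hα J) (Φ.comp W) :=
    { nondegenerate := nondegenerate_of_tendsto (e := fun u => natEmb α hα J u)
        (l := approxUnit A) fun b => by
          have e : ∀ u, (Φ.comp W) (natEmb α hα J u) = natEmb α hα J u := fun u =>
            (congrArg Φ (DFunLike.congr_fun hWT u)).trans (DFunLike.congr_fun hΦS u)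
          simp only [e]
          exact tendsto_natEmb_mul α hα J b
      commutes := fun b => (congrArg Φ (hW.commutes b)).trans (hΦ.commutes _)
      injective := hΦ.injective.comp hW.injective
      preimage_eq := hW.preimage_eq.trans (congrArg (W ⁻¹' ·) hΦ.preimage_eq) }
  have hid : IsCovariantEmbedding (natEndo α hα J) (natEndo α hα J)
      (NonUnitalStarAlgHom.id ℂ (NatExt α hα J)) :=
    { nondegenerate := nondegenerate_of_tendsto (e := fun u => natEmb α hα J u)
        (l := approxUnit A) fun b => tendsto_natEmb_mul α hα J b
      commutes := fun b => rfl
      injective := Function.injective_id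
      preimage_eq := rfl }
  have hΦW : Φ.comp W = NonUnitalStarAlgHom.id ℂ (NatExt α hα J) :=
    covariantEmbedding_unique α hα J hJ hB.reversible hcomp hid (by
      rw [NonUnitalStarAlgHom.comp_assoc, hWT, hΦS]; rfl)
  exact exists_equiv_of_surjective hα hW hWT fun c =>
    ⟨Φ c, hΦ.injective (DFunLike.congr_fun hΦW (Φ c))⟩

end Characterization

end CStarDyn

theorem mainTheorem3 {A : Type u} [NonUnitalCStarAlgebra A] (α : A →⋆ₙₐ[ℂ] A)
    (hα : Extendible α) (J : ClosedIdeal A) (hJ : (J.toSubmodule : Set A) ⊆ kerPerp α) :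
    IsReversibleExtension α (J.toSubmodule : Set A) (natEndo α hα J) (natEmb α hα J) ∧
    IsGeneratedBy (J.toSubmodule : Set A) (natEndo α hα J) (natEmb α hα J) ∧
    IsUniversalExtension.{v} α (J.toSubmodule : Set A) (natEndo α hα J) (natEmb α hα J) ∧
    ∀ (C : Type v) [NonUnitalCStarAlgebra C] (γ : C →⋆ₙₐ[ℂ] C) (S : A →⋆ₙₐ[ℂ] C),
      IsReversible γ → IsEmbedding α γ S →
      (IsGeneratedBy (J.toSubmodule : Set A) γ S ∨
        IsUniversalExtension.{u} α (J.toSubmodule : Set A) γ S) →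
      ∃ W : NatExt α hα J ≃⋆ₐ[ℂ] C,
        (∀ b, W (natEndo α hα J b) = γ (W b)) ∧ ∀ a, W (natEmb α hα J a) = S a := by
  refine ⟨isReversibleExtension_natEmb α hα J hJ, isGeneratedBy_natEmb hJ,
    isUniversalExtension_natEmb α hα J hJ, fun C _ γ S hγ hS h => ?_⟩
  rcases h with h | h
  · exact exists_equiv_of_isGeneratedBy hα hJ hS h
  · exact exists_equiv_of_isUniversalExtension hα hJ hγ hS h
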